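/- Consider a base station (BS) with $M$ antennas, a reconfigurable intelligent surface (RIS) with $N\ge 1$ elements, $K_I$ information users (IUs) and $K_E$ energy users (EUs). The coherence interval has $\tau_c$ symbols, of which $\tau=\tau_I+\tau_E\le\tau_c$ are used for training, and $M>\tau_I$. **Channels.** IU $k$ has channel $\mathbf h_k=\sqrt{\beta_{BI,k}}\,\tilde{\mathbf h}_k\in\mathbb C^M$ with $\tilde{\mathbf h}_k$ having i.i.d. $\mathcal{CN}(0,1)$ entries. EU $\ell$ has cascaded channel $\mathbf g_\ell=\bar{\mathbf g}_\ell+\sqrt{\lambda_\ell}\,\tilde{\mathbf H}_2\boldsymbol\Theta\bar{\mathbf f}_\ell$, where $\bar{\mathbf g}_\ell=\sqrt{\lambda_\ell\delta}\,\mathbf a_M\mathbf a_N^H\boldsymbol\Theta\bar{\mathbf f}_\ell$, $\lambda_\ell=\beta_{RE,\ell}\beta/(\delta+1)$, $\boldsymbol\Theta=\mathrm{diag}(e^{j\psi_1},\dots,e^{j\psi_N})$, the vectors $\mathbf a_M,\mathbf a_N,\bar{\mathbf f}_\ell$ have unit-modulus entries, and $\tilde{\mathbf H}_2\in\mathbb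 C^{M\times N}$ has i.i.d. $\mathcal{CN}(0,1)$ entries. Here $\beta_{BI,k},\beta_{RE,\ell},\beta>0$ and $\delta\ge0$. **Training.** There are $\tau_I$ pilots for the IUs and $\tau_E$ pilots for the EUs, all $\tau$ of them orthonormal in $\mathbb C^\tau$. IU $k$ uses $\varphi_{i_k}$ and EU $\ell$ uses $\bar\varphi_{i_\ell}$; IUs may share pilots, and so may EUs. With pilot power $p>0$ the BS receives $\mathbf Y_p=\sqrt{\tau p}\sum_\ell\mathbf g_\ell\bar\varphi_{i_\ell}^H+\sqrt{\tau p}\sum_k\mathbf h_k\varphi_{i_k}^H+\mathbf N$, where $\mathbf N$ has i.i.d. $\mathcal{CN}(0,\sigma_n^2)$ entries, $\sigma_n^2>0$. The MMSE estimate of a vector $\mathbf x$ from its pilot projection $\mathbf y$ (that is, $\mathbf Y_p\varphi_{i_k}$ or $\mathbf Y_p\bar\varphi_{i_\ell}$) is $\mathbf C_{xy}\mathbf C_{yy}^{-1}(\mathbf y-\mathbb E\mathbf y)+\mathbb E\mathbf x$. Let $\hat{\mathbf h}_k$ be the MMSE estimate of $\mathbf h_k$. Let $\hat{\mathbf g}_\ell$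 be, for all $\ell$, either the MMSE estimate of $\mathbf g_\ell$ with the exact covariances, assumed not to be almost surely zero, or the scalar estimate $$\hat{\mathbf g}_\ell=c_{g_\ell}\big(\mathbf Y_p\bar\varphi_{i_\ell}-\sqrt{\tau p}\textstyle\sum_{\ell'}\bar{\mathbf g}_{\ell'}\bar\varphi_{i_{\ell'}}^H\bar\varphi_{i_\ell}\big)+\bar{\mathbf g}_\ell,$$ $$c_{g_\ell}=\frac{\sqrt{\tau p}\,N\lambda_\ell}{\tau p\big(\sum_{\ell'}N\lambda_{\ell'}|\bar\varphi_{i_{\ell'}}^H\bar\varphi_{i_\ell}|^2+\sum_k\beta_{BI,k}|\varphi_{i_k}^H\bar\varphi_{i_\ell}|^2\big)+\sigma_n^2}.$$ Put $$\gamma_{\hat h_k}=\frac{\tau p\,\beta_{BI,k}^2}{\tau p\big(\sum_{k'}\beta_{BI,k'}|\varphi_{i_{k'}}^H\varphi_{i_k}|^2+\sum_\ell N\lambda_\ell|\bar\varphi_{i_\ell}^H\varphi_{i_k}|^2\big)+\sigma_n^2}.$$ **Partial zero-forcing (PZF).** Let $\hat{\mathbf H}_1=\mathbf Y_p[\varphi_1,\dots,\varphi_{\tau_I}]$,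 $\mathbf w_{I,k}=\alpha_k\hat{\mathbf H}_1(\hat{\mathbf H}_1^H\hat{\mathbf H}_1)^{-1}\mathbf e_{i_k}$ and $\mathbf w_{E,\ell}=\alpha'_\ell\hat{\mathbf g}_\ell$, with $\alpha_k,\alpha'_\ell>0$ normalizing $\mathbb E\|\mathbf w_{I,k}\|^2=\mathbb E\|\mathbf w_{E,\ell}\|^2=1$. The BS sends $\mathbf s=\sum_k\sqrt{p_{I,k}}\,\mathbf w_{I,k}x_{I,k}+\sum_\ell\sqrt{p_{E,\ell}}\,\mathbf w_{E,\ell}x_{E,\ell}$ with i.i.d. $\mathcal{CN}(0,1)$ symbols and powers $p_{I,k},p_{E,\ell}\ge0$, and IU $k$ receives $y_{I,k}=\mathbf h_k^H\mathbf s+n_k$, $n_k\sim\mathcal{CN}(0,\sigma_n^2)$. All fading, noise and symbol variables are independent. Put $\rho_{I,k}=p_{I,k}/\sigma_n^2$ and $\rho_{E,\ell}=p_{E,\ell}/\sigma_n^2$. **Hardening bound.** With $\mathrm{DS}_k=\sqrt{p_{I,k}}\,\mathbb E\{\mathbf h_k^H\mathbf w_{I,k}\}$, the effective SINR is $\mathrm{SINR}_k=\mathbb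 E|\mathrm{DS}_kx_{I,k}|^2/\mathbb E|y_{I,k}-\mathrm{DS}_kx_{I,k}|^2$, and the hardening-bound achievable spectral efficiency is $\mathrm{SE}_k=(1-\tau/\tau_c)\log_2(1+\mathrm{SINR}_k)$. **Proposition.** For every IU $k$, $\gamma_{\hat h_k}=\mathbb E|[\hat{\mathbf h}_k]_m|^2$ for all $m$; $\hat{\mathbf H}_1^H\hat{\mathbf H}_1$ is almost surely invertible; the normalizations above are attained; $\mathbf h_k^H\mathbf w_{I,t}$, $\mathbf h_k^H\mathbf w_{E,\ell}$ and the effective noise $y_{I,k}-\mathrm{DS}_kx_{I,k}$ have finite second moments; and $$\mathrm{SINR}_k=\frac{\rho_{I,k}|\mathbb E\{\mathbf h_k^H\mathbf w_{I,k}\}|^2}{\sum_t\rho_{I,t}\mathbb E|\mathbf h_k^H\mathbf w_{I,t}|^2+\sum_\ell\rho_{E,\ell}\mathbb E|\mathbf h_k^H\mathbf w_{E,\ell}|^2-\rho_{I,k}|\mathbb E\{\mathbf h_k^H\mathbf w_{I,k}\}|^2+1}$$ has the closed form $$\mathrm{SINR}_k=\frac{(M-\tau_I)\rho_{I,k}\gamma_{\hat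 h_k}}{\sum_{t\in\mathcal P_k\setminus\{k\}}(M-\tau_I)\rho_{I,t}\gamma_{\hat h_k}+\sum_{t=1}^{K_I}\rho_{I,t}(\beta_{BI,k}-\gamma_{\hat h_k})+\sum_{\ell=1}^{K_E}\rho_{E,\ell}\beta_{BI,k}+1},$$ where $\mathcal P_k$ is the set of IUs using the same pilot as IU $k$. Hence $\mathrm{SE}_k=(1-\tau/\tau_c)\log_2(1+\mathrm{SINR}_k)$ with this value. -/

import Mathlib

open MeasureTheory ProbabilityTheory Matrix
open scoped NNReal

noncomputable section

/-- The circularly symmetric complex Gaussian law `CN(0, v)` on `ℂ`: independent real and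
imaginary parts, each centred Gaussian with variance `v / 2`. -/
def complexGaussian (v : ℝ≥0) : Measure ℂ :=
  ((gaussianReal 0 (v / 2)).prod (gaussianReal 0 (v / 2))).map
    (fun q : ℝ × ℝ => (q.1 : ℂ) + (q.2 : ℂ) * Complex.I)

/-- Squared Euclidean norm of a complex vector. -/
def sqNorm {m : ℕ} (v : Fin m → ℂ) : ℝ := ∑ i, ‖v i‖ ^ 2

/-- Entrywise expectation of a random complex vector. -/
def meanVec {Ω : Type*} [MeasurableSpace Ω] (P : Measure Ω) {m : ℕ}
    (x : Ω → Fin m → ℂ) : Fin m → ℂ := fun i => ∫ ω, x ω i ∂P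

/-- Cross-covariance matrix `C_{xy} = E[x yᴴ] - E[x] E[y]ᴴ`. -/
def covMat {Ω : Type*} [MeasurableSpace Ω] (P : Measure Ω) {m n : ℕ}
    (x : Ω → Fin m → ℂ) (y : Ω → Fin n → ℂ) : Matrix (Fin m) (Fin n) ℂ :=
  Matrix.of fun i j =>
    (∫ ω, x ω i * star (y ω j) ∂P) - meanVec P x i * star (meanVec P y j)

/-- The MMSE estimate of `x` from `y` in the Gaussian case:
`C_{xy} C_{yy}⁻¹ (y - E[y]) + E[x]`. -/
def mmseEstimate {Ω : Type*} [MeasurableSpace Ω] (P : Measure Ω) {m n : ℕ}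
    (x : Ω → Fin m → ℂ) (y : Ω → Fin n → ℂ) : Ω → Fin m → ℂ := fun ω =>
  (covMat P x y * (covMat P y y)⁻¹) *ᵥ (y ω - meanVec P y) + meanVec P x

/-- Maximum-ratio precoder `ghat / √E‖ghat‖²` built from a channel estimate `ghat`. -/
def mrtPrecoder {Ω : Type*} [MeasurableSpace Ω] (P : Measure Ω) {m : ℕ}
    (ghat : Ω → Fin m → ℂ) (ω : Ω) : Fin m → ℂ :=
  ((1 / √(∫ ω', sqNorm (ghat ω') ∂P) : ℝ) : ℂ) • ghat ω

/-- Deterministic parameters: `M` base-station antennas, `N` reflecting elements, `KI` information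
users (IUs), `KE` energy users (EUs), and `τI + τE` pilots, the first `τI` of them reserved for
the IUs and the other `τE` for the EUs. -/
structure SwiptParams (M N KI KE τI τE : ℕ) where
  /-- length of the coherence interval in symbols -/
  τc : ℕ
  /-- pilot power -/
  p : ℝ
  /-- noise variance -/
  σ2 : ℝ≥0
  /-- large-scale fading BS - IU -/
  βBI : Fin KI → ℝ
  /-- path loss RIS - EU -/
  βRE : Fin KE → ℝ
  /-- path loss BS - RIS -/
  β : ℝ
  /-- Ricean factor -/
  δ : ℝ
  /-- RIS phases -/
  ψ : Fin N → ℝ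
  /-- array response at the BS -/
  aM : Fin M → ℂ
  /-- array response at the RIS -/
  aN : Fin N → ℂ
  /-- line-of-sight channels RIS - EU -/
  f : Fin KE → Fin N → ℂ
  /-- pilots of the IUs -/
  φI : Fin τI → Fin (τI + τE) → ℂ
  /-- pilots of the EUs -/
  φE : Fin τE → Fin (τI + τE) → ℂ
  /-- pilot index of each IU -/
  iI : Fin KI → Fin τI
  /-- pilot index of each EU -/
  iE : Fin KE → Fin τE
  /-- transmit powers for the IUs -/
  pI : Fin KI → ℝ
  /-- transmit powers for the EUs -/
  pE : Fin KE → ℝ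
  τ_le : τI + τE ≤ τc
  p_pos : 0 < p
  σ2_pos : 0 < σ2
  βBI_pos : ∀ k, 0 < βBI k
  βRE_pos : ∀ l, 0 < βRE l
  β_pos : 0 < β
  δ_nonneg : 0 ≤ δ
  aM_unit : ∀ i, ‖aM i‖ = 1
  aN_unit : ∀ i, ‖aN i‖ = 1
  f_unit : ∀ l i, ‖f l i‖ = 1
  φI_orth : ∀ i j, star (φI i) ⬝ᵥ φI j = if i = j then 1 else 0
  φE_orth : ∀ i j, star (φE i) ⬝ᵥ φE j = if i = j then 1 else 0
  φIE_orth : ∀ i j, star (φI i) ⬝ᵥ φE j = 0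
  pI_nonneg : ∀ k, 0 ≤ pI k
  pE_nonneg : ∀ l, 0 ≤ pE l

/-- The random sources: small-scale fading of the IUs, non-line-of-sight BS - RIS fading, uplink
noise during training, information symbols, energy symbols and downlink noise at the IUs. All
entries are mutually independent circularly symmetric complex Gaussian variables. -/
structure SwiptModel (M N KI KE τI τE : ℕ) {Ω : Type*} [MeasurableSpace Ω] (P : Measure Ω)
    extends SwiptParams M N KI KE τI τE where
  hTilde : Fin KI × Fin M → Ω → ℂ
  H2Tilde : Fin M × Fin N → Ω → ℂ
  Nul : Fin M × Fin (τI + τE) → Ω → ℂ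
  xI : Fin KI → Ω → ℂ
  xE : Fin KE → Ω → ℂ
  ndl : Fin KI → Ω → ℂ
  hTilde_meas : ∀ i, Measurable (hTilde i)
  H2Tilde_meas : ∀ i, Measurable (H2Tilde i)
  Nul_meas : ∀ i, Measurable (Nul i)
  xI_meas : ∀ i, Measurable (xI i)
  xE_meas : ∀ i, Measurable (xE i)
  ndl_meas : ∀ i, Measurable (ndl i)
  hTilde_law : ∀ i, P.map (hTilde i) = complexGaussian 1
  H2Tilde_law : ∀ i, P.map (H2Tilde i) = complexGaussian 1
  Nul_law : ∀ i, P.map (Nul i) = complexGaussian σ2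
  xI_law : ∀ i, P.map (xI i) = complexGaussian 1
  xE_law : ∀ i, P.map (xE i) = complexGaussian 1
  ndl_law : ∀ i, P.map (ndl i) = complexGaussian σ2
  indep : iIndepFun
    (Sum.elim hTilde (Sum.elim H2Tilde (Sum.elim Nul (Sum.elim xI (Sum.elim xE ndl))))) P

namespace SwiptParams

variable {M N KI KE τI τE : ℕ} (D : SwiptParams M N KI KE τI τE)

/-- Energy per pilot sequence `τ p`, where `τ = τI + τE`. -/
def τp : ℝ := ((τI + τE : ℕ) : ℝ) * D.p

/-- `λ_ℓ = β_{RE,ℓ} β / (δ + 1)`. -/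
def lam (l : Fin KE) : ℝ := D.βRE l * D.β / (D.δ + 1)

/-- RIS phase-shift matrix. -/
def Θ : Matrix (Fin N) (Fin N) ℂ :=
  Matrix.diagonal fun i => Complex.exp (Complex.I * (D.ψ i : ℂ))

/-- Line-of-sight component of the BS - RIS channel. -/
def H2bar : Matrix (Fin M) (Fin N) ℂ := Matrix.vecMulVec D.aM (star D.aN)

/-- Line-of-sight (mean) part of the cascaded channel of EU `l`. -/
def gbar (l : Fin KE) : Fin M → ℂ :=
  (√(D.lam l * D.δ) : ℂ) • (D.H2bar *ᵥ (D.Θ *ᵥ D.f l))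

/-- SNR of the information symbol of IU `k`. -/
def ρI (k : Fin KI) : ℝ := D.pI k / D.σ2

/-- SNR of the energy symbol of EU `l`. -/
def ρE (l : Fin KE) : ℝ := D.pE l / D.σ2

/-- Pilot book of the IUs, one pilot per column. -/
def ΦI : Matrix (Fin (τI + τE)) (Fin τI) ℂ := Matrix.of fun s i => D.φI i s

/-- Coefficient `c_{h_k}` of the channel estimate of IU `k`. -/
def cH (k : Fin KI) : ℝ :=
  √D.τp * D.βBI k /
    (D.τp * ((∑ k', D.βBI k' * ‖star (D.φI (D.iI k')) ⬝ᵥ D.φI (D.iI k)‖ ^ 2)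
        + ∑ l, (N : ℝ) * D.lam l * ‖star (D.φE (D.iE l)) ⬝ᵥ D.φI (D.iI k)‖ ^ 2)
      + D.σ2)

/-- Mean square `γ_{ĥ_k} = √(τp) β_{BI,k} c_{h_k}` of the channel estimate of IU `k`. -/
def γH (k : Fin KI) : ℝ := √D.τp * D.βBI k * D.cH k

/-- Scalar coefficient `c_{g_ℓ}` of the channel estimate of EU `l`. -/
def cG (l : Fin KE) : ℝ :=
  √D.τp * ((N : ℝ) * D.lam l) /
    (D.τp * ((∑ l', (N : ℝ) * D.lam l' * ‖star (D.φE (D.iE l')) ⬝ᵥ D.φE (D.iE l)‖ ^ 2)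
        + ∑ k, D.βBI k * ‖star (D.φI (D.iI k)) ⬝ᵥ D.φE (D.iE l)‖ ^ 2)
      + D.σ2)

/-- The IUs that use the same pilot as IU `k` (including `k`). -/
def sharers (k : Fin KI) : Finset (Fin KI) := Finset.univ.filter fun t => D.iI t = D.iI k

/-- Closed-form effective SINR of IU `k` under partial zero-forcing. -/
def sinrPZF (k : Fin KI) : ℝ :=
  ((M : ℝ) - τI) * D.ρI k * D.γH k /
    ((∑ t ∈ (D.sharers k).erase k, ((M : ℝ) - τI) * D.ρI t * D.γH k)
      + (∑ t, D.ρI t * (D.βBI k - D.γH k))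
      + (∑ l, D.ρE l * D.βBI k) + 1)

end SwiptParams

namespace SwiptModel

variable {M N KI KE τI τE : ℕ} {Ω : Type*} [MeasurableSpace Ω] {P : Measure Ω}
  (D : SwiptModel M N KI KE τI τE P)

/-- Channel of IU `k`. -/
def h (k : Fin KI) (ω : Ω) : Fin M → ℂ := fun m => (√(D.βBI k) : ℂ) * D.hTilde (k, m) ω

/-- Cascaded BS - RIS - EU channel of EU `l`. -/
def g (l : Fin KE) (ω : Ω) : Fin M → ℂ :=
  D.gbar l + (√(D.lam l) : ℂ) •
    ((Matrix.of fun m n => D.H2Tilde (m, n) ω) *ᵥ (D.Θ *ᵥ D.f l))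

/-- Received pilot signal at the BS. -/
def Yp (ω : Ω) : Matrix (Fin M) (Fin (τI + τE)) ℂ :=
  (√D.τp : ℂ) • (∑ l, Matrix.vecMulVec (D.g l ω) (star (D.φE (D.iE l))))
    + (√D.τp : ℂ) • (∑ k, Matrix.vecMulVec (D.h k ω) (star (D.φI (D.iI k))))
    + Matrix.of fun m s => D.Nul (m, s) ω

/-- Projection of the received pilots onto the pilot of IU `k`. -/
def yI (k : Fin KI) (ω : Ω) : Fin M → ℂ := D.Yp ω *ᵥ D.φI (D.iI k)

/-- Projection of the received pilots onto the pilot of EU `l`. -/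
def yE (l : Fin KE) (ω : Ω) : Fin M → ℂ := D.Yp ω *ᵥ D.φE (D.iE l)

/-- MMSE estimate of the channel of IU `k`. -/
def hHat (k : Fin KI) : Ω → Fin M → ℂ := mmseEstimate P (D.h k) (D.yI k)

/-- MMSE estimate of the channel of EU `l`, with the exact covariance matrices. -/
def gHat (l : Fin KE) : Ω → Fin M → ℂ := mmseEstimate P (D.g l) (D.yE l)

/-- The estimate of the channel of EU `l` with the scalar coefficient `c_{g_ℓ}` (it ignores the
correlation between the cascaded channels of different EUs). -/
def gHatScalar (l : Fin KE) (ω : Ω) : Fin M → ℂ :=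
  (D.cG l : ℂ) • (D.yE l ω - (√D.τp : ℂ) •
      ∑ l', (star (D.φE (D.iE l')) ⬝ᵥ D.φE (D.iE l)) • D.gbar l')
    + D.gbar l

/-- Matrix of the (unscaled) channel estimates of the IUs, one column per pilot. -/
def H1 (ω : Ω) : Matrix (Fin M) (Fin τI) ℂ := D.Yp ω * D.ΦI

/-- Unnormalized zero-forcing direction of IU `k`. -/
def zfDir (k : Fin KI) (ω : Ω) : Fin M → ℂ :=
  (D.H1 ω * ((D.H1 ω)ᴴ * D.H1 ω)⁻¹) *ᵥ Pi.single (D.iI k) 1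

/-- Zero-forcing precoder of IU `k`. -/
def wI (k : Fin KI) (ω : Ω) : Fin M → ℂ :=
  ((1 / √(∫ ω', sqNorm (D.zfDir k ω') ∂P) : ℝ) : ℂ) • D.zfDir k ω

/-- Signal transmitted by the BS under partial zero-forcing. -/
def txSignal (ghat : Fin KE → Ω → Fin M → ℂ) (ω : Ω) : Fin M → ℂ :=
  (∑ k, ((√(D.pI k) : ℂ) * D.xI k ω) • D.wI k ω)
    + ∑ l, ((√(D.pE l) : ℂ) * D.xE l ω) • mrtPrecoder P (ghat l) ω

/-- Signal received by IU `k`. -/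
def rxSignal (ghat : Fin KE → Ω → Fin M → ℂ) (k : Fin KI) (ω : Ω) : ℂ :=
  star (D.h k ω) ⬝ᵥ D.txSignal ghat ω + D.ndl k ω

/-- Strength of the desired signal of IU `k`, known at the receiver. -/
def DS (k : Fin KI) : ℂ := (√(D.pI k) : ℂ) * ∫ ω, star (D.h k ω) ⬝ᵥ D.wI k ω ∂P

/-- Effective noise at IU `k`: beamforming gain uncertainty, interference from the other IUs and
from the energy signals, and thermal noise. -/
def effNoise (ghat : Fin KE → Ω → Fin M → ℂ) (k : Fin KI) (ω : Ω) : ℂ :=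
  D.rxSignal ghat k ω - D.DS k * D.xI k ω

/-- Effective SINR in the hardening bound: power of the desired signal over power of the
effective noise. -/
def sinr (ghat : Fin KE → Ω → Fin M → ℂ) (k : Fin KI) : ℝ :=
  (∫ ω, ‖D.DS k * D.xI k ω‖ ^ 2 ∂P) / ∫ ω, ‖D.effNoise ghat k ω‖ ^ 2 ∂P

/-- Achievable spectral efficiency (bit/s/Hz) of IU `k` given by the hardening bound. -/
def SE (ghat : Fin KE → Ω → Fin M → ℂ) (k : Fin KI) : ℝ :=
  (1 - ((τI + τE : ℕ) : ℝ) / D.τc) * Real.logb 2 (1 + D.sinr ghat k)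

end SwiptModel

end

/-!
Write `y_i` for the columns of `H1`, the IU pilot projections. By orthonormality of the pilots the
EU channels drop out, and `y_i` is a linear form in the fading of the IUs on pilot `i` and in the
noise, with the same coefficients on every antenna. So the `y_i` are independent, and the entries of
`y_i` are independent complex Gaussian variables of variance `s_i = τp ∑ β_k + σ²`, the sum being
over the users of pilot `i`. The MMSE estimate is `ĥ_k = c_k y_{i_k}` with a real `c_k`, and
`γ_k = c_k² s_{i_k}`.

*Independence of the estimation error.* Put `e_k = h_k - ĥ_k`. On each antenna the coefficient
vectors of `e_k` and of all `y_i` are orthogonal with respect to the source variances. Orthogonal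
linear forms in independent complex Gaussian variables are independent, because their joint
characteristic function factors (`iIndepFun_linearForms`). So `e_k` has independent entries of
variance `β_k - γ_k` and is independent of `H1`.

*Zero-forcing.* The unnormalized direction `z_i = H1 (H1ᴴ H1)⁻¹ e_i` satisfies `y_jᴴ z_i = δ_ij`.
Hence `h_kᴴ z_i = c_k δ_{i, i_k} + e_kᴴ z_i`, where the second term is centred with mean square
`(β_k - γ_k) E‖z_i‖²`.

*Normalization.* `‖z_i‖²` is the inverse of the squared norm of the component of `y_i` orthogonal to
the other columns. Those columns are independent of `y_i`, so conditionally on them that component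
has `M - τI + 1` independent Gaussian coordinates of variance `s_i`, and
`E (∑_{j < d} |g_j|²)⁻¹ = ∫_0^∞ (1 + s t)^{-d} dt = 1 / (s (d - 1))`
(`lintegral_inv_sum_norm_sq`) yields `E‖z_i‖² = 1 / (s_i (M - τI))`. This is the inverse moment of a
complex Wishart matrix, and also the source of the factor `M - τI` in the closed form. The columns
are almost surely linearly independent because each avoids the span of the earlier ones, a proper
subspace, which is a null set.

*Energy beams.* Both energy estimates are functions of the EU pilot projections. The IU pilots being
orthogonal to those of the EUs, these involve only the fading between the base station and the RIS
and the training noise. Hence `h_k` is independent of a beam of mean square norm one, and the gain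
has mean square `β_k`.

*SINR.* The downlink symbols and noise are centred, uncorrelated and independent of the channels and
precoders, so the powers of the terms of the effective noise add up, the desired signal losing its
mean.
-/

noncomputable section

/-! ### The circularly symmetric complex Gaussian law -/

instance isProbabilityMeasure_complexGaussian (v : ℝ≥0) :
    IsProbabilityMeasure (complexGaussian v) :=
  Measure.isProbabilityMeasure_map (by fun_prop)

theorem charFun_complexGaussian (v : ℝ≥0) (t : ℂ) :
    charFun (complexGaussian v) t = Complex.exp (-(v * ‖t‖ ^ 2 / 4 : ℝ)) := by
  rw [charFun_apply, complexGaussian, integral_map (by fun_prop) (by fun_prop)]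
  have key : ∀ q : ℝ × ℝ,
      Complex.exp ((inner ℝ ((q.1 : ℂ) + (q.2 : ℂ) * Complex.I) t : ℝ) * Complex.I) =
        Complex.exp (t.re * q.1 * Complex.I) * Complex.exp (t.im * q.2 * Complex.I) := by
    intro q
    rw [← Complex.exp_add]
    congr 1
    simp [Complex.inner]
    ring
  simp_rw [key]
  rw [integral_prod_mul (fun x : ℝ => Complex.exp (t.re * x * Complex.I))
    (fun x : ℝ => Complex.exp (t.im * x * Complex.I)), ← charFun_apply_real, ← charFun_apply_real,
    charFun_gaussianReal, charFun_gaussianReal, ← Complex.exp_add, Complex.sq_norm,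
    Complex.normSq_apply]
  congr 1
  push_cast
  ring

/-- The Laplace transform of the square of a centred real Gaussian variable. -/
theorem lintegral_exp_neg_mul_sq_gaussianReal {v : ℝ≥0} (hv : 0 < v) {t : ℝ} (ht : 0 ≤ t) :
    ∫⁻ x, ENNReal.ofReal (Real.exp (-(t * x ^ 2))) ∂gaussianReal 0 v =
      ENNReal.ofReal (1 / √(1 + 2 * v * t)) := by
  have hv' : (0 : ℝ) < v := hv
  have hb : 0 < t + 1 / (2 * v) := by positivity
  rw [gaussianReal_of_var_ne_zero _ hv.ne',
    lintegral_withDensity_eq_lintegral_mul _ (measurable_gaussianPDF _ _) (by fun_prop)]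
  have key : ∀ x : ℝ, (gaussianPDF 0 v * fun x : ℝ => ENNReal.ofReal (Real.exp (-(t * x ^ 2)))) x =
      ENNReal.ofReal ((√(2 * Real.pi * v))⁻¹ * Real.exp (-(t + 1 / (2 * v)) * x ^ 2)) := by
    intro x
    rw [Pi.mul_apply, gaussianPDF, ← ENNReal.ofReal_mul (gaussianPDFReal_nonneg _ _ _),
      gaussianPDFReal, mul_assoc, ← Real.exp_add]
    congr 3
    field_simp
    ring
  simp_rw [key]
  rw [← ofReal_integral_eq_lintegral_ofReal ((integrable_exp_neg_mul_sq hb).const_mul _)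
    (Filter.Eventually.of_forall fun x => by positivity), integral_const_mul, integral_gaussian,
    ← Real.sqrt_inv, ← Real.sqrt_mul (by positivity), one_div (√_), ← Real.sqrt_inv]
  congr 2
  have := Real.pi_pos
  field_simp
  ring

/-- If `Z` has law `CN(0, v)` then `|Z|²` is exponential of mean `v`; its Laplace transform. -/
theorem lintegral_exp_neg_mul_norm_sq_complexGaussian {v : ℝ≥0} (hv : 0 < v) {t : ℝ}
    (ht : 0 ≤ t) :
    ∫⁻ z, ENNReal.ofReal (Real.exp (-(t * ‖z‖ ^ 2))) ∂complexGaussian v =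
      ENNReal.ofReal (1 / (1 + v * t)) := by
  rw [complexGaussian, lintegral_map (by fun_prop) (by fun_prop)]
  have key : ∀ q : ℝ × ℝ,
      ENNReal.ofReal (Real.exp (-(t * ‖(q.1 : ℂ) + (q.2 : ℂ) * Complex.I‖ ^ 2))) =
        ENNReal.ofReal (Real.exp (-(t * q.1 ^ 2))) *
          ENNReal.ofReal (Real.exp (-(t * q.2 ^ 2))) := by
    intro q
    rw [← ENNReal.ofReal_mul (by positivity), ← Real.exp_add, Complex.sq_norm,
      Complex.normSq_apply]
    congr 2
    simp
    ring
  have hv2 : 0 < v / 2 := by positivity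
  simp_rw [key]
  rw [lintegral_prod_mul (f := fun x : ℝ => ENNReal.ofReal (Real.exp (-(t * x ^ 2))))
      (g := fun x : ℝ => ENNReal.ofReal (Real.exp (-(t * x ^ 2))))
      (by fun_prop) (by fun_prop), lintegral_exp_neg_mul_sq_gaussianReal hv2 ht,
    ← ENNReal.ofReal_mul (by positivity), div_mul_div_comm, Real.mul_self_sqrt (by positivity)]
  congr 2
  · ring
  · push_cast; ring

theorem complexGaussian_singleton_zero {v : ℝ≥0} (hv : 0 < v) : complexGaussian v {0} = 0 := by
  have hv2 : v / 2 ≠ 0 := by positivity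
  have := nullSingletonClass_gaussianReal (μ := 0) hv2
  rw [complexGaussian, Measure.map_apply (by fun_prop) (measurableSet_singleton _)]
  refine measure_mono_null (t := {(0 : ℝ)} ×ˢ Set.univ) ?_ (by simp [Measure.prod_prod])
  intro q hq
  have := congrArg Complex.re (show (q.1 : ℂ) + (q.2 : ℂ) * Complex.I = 0 from hq)
  simpa using this

section Moments

variable {Ω : Type*} [MeasurableSpace Ω] {P : Measure Ω}

theorem memLp_two_complexGaussian (v : ℝ≥0) : MemLp (fun z : ℂ => z) 2 (complexGaussian v) := by
  have h1 : MemLp (fun q : ℝ × ℝ => (q.1 : ℂ)) 2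
      ((gaussianReal 0 (v / 2)).prod (gaussianReal 0 (v / 2))) :=
    ((memLp_id_gaussianReal' 2 (by simp)).ofReal (K := ℂ)).comp_fst _
  have h2 : MemLp (fun q : ℝ × ℝ => (q.2 : ℂ)) 2
      ((gaussianReal 0 (v / 2)).prod (gaussianReal 0 (v / 2))) :=
    ((memLp_id_gaussianReal' 2 (by simp)).ofReal (K := ℂ)).comp_snd _
  rw [complexGaussian, memLp_map_measure_iff (by fun_prop) (by fun_prop)]
  exact h1.add (h2.mul_const Complex.I)

theorem integral_complexGaussian (v : ℝ≥0) : ∫ z, z ∂complexGaussian v = 0 := by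
  have h1 : Integrable (fun x : ℝ => (x : ℂ)) (gaussianReal 0 (v / 2)) :=
    (((memLp_id_gaussianReal' 1 (by simp)).integrable le_rfl)).ofReal
  rw [complexGaussian, integral_map (by fun_prop) (by fun_prop),
    integral_add (h1.comp_fst _) ((h1.comp_snd _).mul_const _), integral_mul_const,
    integral_fun_fst (f := fun x : ℝ => (x : ℂ)), integral_fun_snd (f := fun x : ℝ => (x : ℂ)),
    integral_complex_ofReal]
  have := integral_id_gaussianReal (μ := 0) (v := v / 2)
  simp [this]

theorem integral_norm_sq_complexGaussian (v : ℝ≥0) : ∫ z, ‖z‖ ^ 2 ∂complexGaussian v = v := by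
  have hsq : ∫ x : ℝ, x ^ 2 ∂gaussianReal 0 (v / 2) = v / 2 := by
    have := variance_eq_integral (μ := gaussianReal 0 (v / 2)) (X := id) aemeasurable_id
    rw [variance_id_gaussianReal] at this
    simp only [id, integral_id_gaussianReal, sub_zero] at this
    rw [← this]; simp
  have h1 : Integrable (fun x : ℝ => x ^ 2) (gaussianReal 0 (v / 2)) :=
    (memLp_id_gaussianReal' 2 (by simp)).integrable_sq
  rw [complexGaussian, integral_map (by fun_prop) (by fun_prop)]
  have key : ∀ q : ℝ × ℝ, ‖(q.1 : ℂ) + (q.2 : ℂ) * Complex.I‖ ^ 2 = q.1 ^ 2 + q.2 ^ 2 := by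
    intro q
    rw [Complex.sq_norm, Complex.normSq_apply]
    simp
    ring
  simp_rw [key]
  rw [integral_add (h1.comp_fst _) (h1.comp_snd _),
    integral_fun_fst (f := fun x : ℝ => x ^ 2), integral_fun_snd (f := fun x : ℝ => x ^ 2), hsq]
  simp

theorem memLp_two_of_map_eq {X : Ω → ℂ} (hX : Measurable X) {v : ℝ≥0}
    (hlaw : P.map X = complexGaussian v) : MemLp X 2 P := by
  have := memLp_two_complexGaussian v
  rw [← hlaw] at this
  exact (memLp_map_measure_iff (by fun_prop) hX.aemeasurable).1 this

theorem integral_of_map_eq {X : Ω → ℂ} (hX : Measurable X) {v : ℝ≥0}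
    (hlaw : P.map X = complexGaussian v) : ∫ ω, X ω ∂P = 0 := by
  rw [← integral_complexGaussian v, ← hlaw, integral_map hX.aemeasurable (by fun_prop)]

theorem integral_norm_sq_of_map_eq {X : Ω → ℂ} (hX : Measurable X) {v : ℝ≥0}
    (hlaw : P.map X = complexGaussian v) : ∫ ω, ‖X ω‖ ^ 2 ∂P = v := by
  rw [← integral_norm_sq_complexGaussian v, ← hlaw, integral_map hX.aemeasurable (by fun_prop)]

/-- Independent centred complex Gaussian variables are uncorrelated. -/
theorem integral_mul_star_of_iIndepFun {ι : Type*} [DecidableEq ι] {X : ι → Ω → ℂ}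
    (hX : ∀ i, Measurable (X i)) {v : ι → ℝ≥0} (hlaw : ∀ i, P.map (X i) = complexGaussian (v i))
    (hind : iIndepFun X P) (i j : ι) :
    ∫ ω, X i ω * star (X j ω) ∂P = if i = j then ((v i : ℝ) : ℂ) else 0 := by
  split_ifs with h
  · subst h
    rw [← integral_norm_sq_of_map_eq (hX i) (hlaw i), ← integral_complex_ofReal]
    refine integral_congr_ae (Filter.Eventually.of_forall fun ω => ?_)
    simp [Complex.mul_conj, Complex.normSq_eq_norm_sq]
  · have h2 : IndepFun (X i) (fun ω => star (X j ω)) P :=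
      (hind.indepFun h).comp measurable_id (by fun_prop : Measurable fun z : ℂ => star z)
    rw [h2.integral_fun_mul_eq_mul_integral (hX i).aestronglyMeasurable
      (by have := hX j; fun_prop), integral_of_map_eq (hX i) (hlaw i), zero_mul]

end Moments

/-! ### Linear forms in independent complex Gaussian variables -/

section LinearForms

variable {Ω ι κ : Type*} [MeasurableSpace Ω] {P : Measure Ω} [Fintype ι] [Fintype κ]

theorem integral_exp_sum_inner_of_iIndepFun {X : ι → Ω → ℂ} (hX : ∀ i, Measurable (X i))
    {v : ι → ℝ≥0} (hlaw : ∀ i, P.map (X i) = complexGaussian (v i)) (hind : iIndepFun X P)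
    (u : ι → ℂ) :
    ∫ ω, Complex.exp ((∑ i, inner ℝ (X i ω) (u i) : ℝ) * Complex.I) ∂P =
      Complex.exp (-((∑ i, v i * ‖u i‖ ^ 2) / 4 : ℝ)) := by
  have key : ∀ ω, Complex.exp ((∑ i, inner ℝ (X i ω) (u i) : ℝ) * Complex.I) =
      ∏ i, Complex.exp ((inner ℝ (X i ω) (u i) : ℝ) * Complex.I) := by
    intro ω
    rw [← Complex.exp_sum]
    push_cast
    rw [Finset.sum_mul]
  simp_rw [key]
  rw [hind.integral_fun_prod_comp (f := fun i z => Complex.exp ((inner ℝ z (u i) : ℝ) * Complex.I))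
    (fun i => (hX i).aemeasurable) (fun i => by fun_prop)]
  have h2 : ∀ i, ∫ ω, Complex.exp ((inner ℝ (X i ω) (u i) : ℝ) * Complex.I) ∂P =
      Complex.exp (-(v i * ‖u i‖ ^ 2 / 4 : ℝ)) := by
    intro i
    rw [← charFun_complexGaussian, ← hlaw i, charFun_apply,
      integral_map (hX i).aemeasurable (by fun_prop)]
  simp_rw [h2]
  rw [← Complex.exp_sum]
  congr 1
  push_cast
  rw [Finset.sum_neg_distrib, Finset.sum_div]

theorem inner_mul_left_eq_inner_star_mul (b x t : ℂ) :
    (inner ℝ (b * x) t : ℝ) = inner ℝ x (star b * t) := by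
  simp [Complex.inner]
  ring

theorem map_linearForm_eq_complexGaussian {X : ι → Ω → ℂ} (hX : ∀ i, Measurable (X i))
    {v : ι → ℝ≥0} (hlaw : ∀ i, P.map (X i) = complexGaussian (v i)) (hind : iIndepFun X P)
    (b : ι → ℂ) :
    P.map (fun ω => ∑ i, b i * X i ω) = complexGaussian (∑ i, v i * ‖b i‖₊ ^ 2) := by
  have := hind.isProbabilityMeasure
  have hm : Measurable fun ω => ∑ i, b i * X i ω :=
    Finset.measurable_sum _ fun i _ => (hX i).const_mul _
  have := Measure.isProbabilityMeasure_map (μ := P) hm.aemeasurable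
  refine Measure.ext_of_charFun (funext fun t => ?_)
  rw [charFun_apply, integral_map hm.aemeasurable (by fun_prop), charFun_complexGaussian]
  have := integral_exp_sum_inner_of_iIndepFun hX hlaw hind fun i => star (b i) * t
  simp_rw [sum_inner, inner_mul_left_eq_inner_star_mul]
  rw [this]
  congr 3
  push_cast
  rw [Finset.sum_mul]
  congr 1
  exact Finset.sum_congr rfl fun i _ => by rw [norm_mul, norm_star]; ring

/-- Linear forms in independent centred complex Gaussian variables whose coefficient vectors are
orthogonal for the weights given by the variances are independent: uncorrelated jointly circular
Gaussian variables are independent. -/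
theorem iIndepFun_linearForms {X : ι → Ω → ℂ} (hX : ∀ i, Measurable (X i))
    {v : ι → ℝ≥0} (hlaw : ∀ i, P.map (X i) = complexGaussian (v i)) (hind : iIndepFun X P)
    (b : κ → ι → ℂ)
    (hb : ∀ j j', j ≠ j' → ∑ i, ((v i : ℝ) : ℂ) * (b j i * star (b j' i)) = 0) :
    iIndepFun (fun j ω => ∑ i, b j i * X i ω) P := by
  have := hind.isProbabilityMeasure
  have hm : ∀ j, Measurable fun ω => ∑ i, b j i * X i ω := fun j =>
    Finset.measurable_sum _ fun i _ => (hX i).const_mul _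
  rw [iIndepFun_iff_charFun_pi fun j => (hm j).aemeasurable]
  intro t
  have hm2 : Measurable fun ω => WithLp.toLp 2 fun j => ∑ i, b j i * X i ω := by
    have := measurable_pi_lambda _ hm
    fun_prop
  rw [charFun_apply, integral_map hm2.aemeasurable (by fun_prop)]
  have h1 : ∀ ω, (inner ℝ (WithLp.toLp 2 fun j => ∑ i, b j i * X i ω) t : ℝ) =
      ∑ i, inner ℝ (X i ω) (∑ j, star (b j i) * t j) := by
    intro ω
    simp_rw [PiLp.inner_apply, sum_inner, inner_mul_left_eq_inner_star_mul, inner_sum]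
    exact Finset.sum_comm
  simp_rw [h1]
  rw [integral_exp_sum_inner_of_iIndepFun hX hlaw hind]
  simp_rw [map_linearForm_eq_complexGaussian hX hlaw hind, charFun_complexGaussian]
  rw [← Complex.exp_sum]
  congr 1
  -- the off-diagonal terms of the quadratic form in `t` vanish by orthogonality
  have h2 : ∑ i, ((v i : ℝ) : ℂ) * ((∑ j, star (b j i) * t j) * star (∑ j, star (b j i) * t j)) =
      ∑ j, (∑ i, ((v i : ℝ) : ℂ) * (b j i * star (b j i))) * (t j * star (t j)) := by
    have : ∀ j, (∑ i, ((v i : ℝ) : ℂ) * (b j i * star (b j i))) * (t j * star (t j)) =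
        ∑ j', (∑ i, ((v i : ℝ) : ℂ) * (b j' i * star (b j i))) * (t j * star (t j')) := by
      intro j
      rw [Finset.sum_eq_single j _ (by simp)]
      intro j' _ hj
      rw [hb _ _ hj, zero_mul]
    simp_rw [this, Finset.sum_mul, star_sum, star_mul', star_star, Finset.mul_sum]
    rw [Finset.sum_comm]
    refine Finset.sum_congr rfl fun j _ => ?_
    rw [Finset.sum_comm]
    refine Finset.sum_congr rfl fun j' _ => Finset.sum_congr rfl fun i _ => by ring
  have h3 : ∀ z : ℂ, z * star z = ((‖z‖ ^ 2 : ℝ) : ℂ) := fun z => by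
    simp [Complex.mul_conj, Complex.normSq_eq_norm_sq]
  simp_rw [h3] at h2
  norm_cast at h2
  norm_cast
  rw [h2, Finset.sum_neg_distrib, Finset.sum_div]
  push_cast
  rfl

/-- Applying the same linear map to each row of a matrix of independent complex Gaussian
variables, with orthogonal coefficient vectors, gives independent entries. -/
theorem iIndepFun_row_linearForms {μ : Type*} [Fintype μ] [DecidableEq μ]
    {X : ι × μ → Ω → ℂ} (hX : ∀ i, Measurable (X i))
    {v : ι → ℝ≥0} (hlaw : ∀ i, P.map (X i) = complexGaussian (v i.1)) (hind : iIndepFun X P)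
    (c : κ → ι → ℂ)
    (hc : ∀ j j', j ≠ j' → ∑ i, ((v i : ℝ) : ℂ) * (c j i * star (c j' i)) = 0) :
    iIndepFun (fun (j : κ × μ) ω => ∑ i, c j.1 i * X (i, j.2) ω) P ∧
      ∀ j : κ × μ, P.map (fun ω => ∑ i, c j.1 i * X (i, j.2) ω) =
        complexGaussian (∑ i, v i * ‖c j.1 i‖₊ ^ 2) := by
  have hinj : ∀ m : μ, Function.Injective fun i : ι => (i, m) := fun m i i' h => by simpa using h
  refine ⟨?_, fun j => map_linearForm_eq_complexGaussian (fun i => hX (i, j.2))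
    (fun i => hlaw (i, j.2)) (hind.precomp (hinj j.2)) _⟩
  have := iIndepFun_linearForms hX hlaw hind
    (fun (j : κ × μ) (i : ι × μ) => if i.2 = j.2 then c j.1 i.1 else 0) ?_
  · convert! this using 3 with j ω
    simp [Fintype.sum_prod_type]
  · rintro ⟨j, m⟩ ⟨j', m'⟩ hne
    rw [Fintype.sum_prod_type_right]
    by_cases hm : m = m'
    · subst hm
      have hj : j ≠ j' := fun h => hne (by rw [h])
      rw [Finset.sum_eq_single m (fun x _ hx => by simp [hx]) (by simp)]
      simpa using hc j j' hj
    · refine Finset.sum_eq_zero fun x _ => Finset.sum_eq_zero fun i _ => ?_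
      by_cases hx : x = m
      · subst hx; simp [hm]
      · simp [hx]

end LinearForms

theorem measurable_of_entries {Ω ι : Type*} {m₀ : MeasurableSpace Ω} {f : Ω → ι → ℂ}
    (hf : ∀ i, Measurable[m₀] fun ω => f ω i) : Measurable[m₀] f :=
  measurable_pi_lambda _ hf

/-! ### Random linear forms with independent coefficients -/

section Independence

variable {Ω ι : Type*} [MeasurableSpace Ω] {P : Measure Ω}

theorem indepFun_of_indep {β γ : Type*} [MeasurableSpace β] [MeasurableSpace γ]
    {m₁ m₂ : MeasurableSpace Ω} (h : Indep m₁ m₂ P) {f : Ω → β} {g : Ω → γ}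
    (hf : Measurable[m₁] f) (hg : Measurable[m₂] g) : IndepFun f g P :=
  indep_of_indep_of_le_left (indep_of_indep_of_le_right h hg.comap_le) hf.comap_le

variable [Fintype ι]

theorem integrable_mul_star_of_memLp_two {X Y : Ω → ℂ} (hX : MemLp X 2 P) (hY : MemLp Y 2 P) :
    Integrable (fun ω => X ω * star (Y ω)) P :=
  hX.integrable_mul hY.star

theorem memLp_two_mul_of_indepFun {X A : Ω → ℂ} (hX : MemLp X 2 P) (hA : MemLp A 2 P)
    (hind : IndepFun X A P) : MemLp (fun ω => X ω * A ω) 2 P := by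
  have hm : AEStronglyMeasurable (fun ω => X ω * A ω) P := hX.1.mul hA.1
  rw [memLp_two_iff_integrable_sq_norm hm]
  have h : IndepFun (fun ω => ‖X ω‖ ^ 2) (fun ω => ‖A ω‖ ^ 2) P :=
    hind.comp (φ := fun z => ‖z‖ ^ 2) (ψ := fun z => ‖z‖ ^ 2) (by fun_prop) (by fun_prop)
  refine (h.integrable_mul ((memLp_two_iff_integrable_sq_norm hX.1).1 hX)
    ((memLp_two_iff_integrable_sq_norm hA.1).1 hA)).congr (Filter.Eventually.of_forall fun ω => ?_)
  simp [mul_pow]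

theorem memLp_two_sum_mul {X A : ι → Ω → ℂ} (hX : ∀ i, MemLp (X i) 2 P)
    (hA : ∀ i, MemLp (A i) 2 P) (hind : IndepFun (fun ω i => X i ω) (fun ω i => A i ω) P) :
    MemLp (fun ω => ∑ i, X i ω * A i ω) 2 P :=
  memLp_finsetSum _ fun i _ => memLp_two_mul_of_indepFun (hX i) (hA i)
    (hind.comp (measurable_pi_apply i) (measurable_pi_apply i))

theorem integral_sum_mul_eq_zero {X A : ι → Ω → ℂ} [IsProbabilityMeasure P]
    (hX : ∀ i, MemLp (X i) 2 P)
    (hA : ∀ i, MemLp (A i) 2 P) (hind : IndepFun (fun ω i => X i ω) (fun ω i => A i ω) P)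
    (h0 : ∀ i, ∫ ω, X i ω ∂P = 0) : ∫ ω, ∑ i, X i ω * A i ω ∂P = 0 := by
  have hi : ∀ i, IndepFun (X i) (A i) P := fun i =>
    hind.comp (measurable_pi_apply i) (measurable_pi_apply i)
  rw [integral_finsetSum _ fun i _ => (memLp_two_mul_of_indepFun (hX i) (hA i) (hi i)).integrable
    (by norm_num)]
  refine Finset.sum_eq_zero fun i _ => ?_
  rw [(hi i).integral_fun_mul_eq_mul_integral (hX i).1 (hA i).1, h0, zero_mul]

/-- Second moment of a linear form in uncorrelated variables `X i` whose random coefficients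
`A i` are independent of the `X i`. -/
theorem integral_norm_sq_sum_mul [DecidableEq ι] {X A : ι → Ω → ℂ} (hX : ∀ i, MemLp (X i) 2 P)
    (hA : ∀ i, MemLp (A i) 2 P) (hind : IndepFun (fun ω i => X i ω) (fun ω i => A i ω) P)
    {v : ι → ℝ} (hv : ∀ i j, ∫ ω, X i ω * star (X j ω) ∂P = if i = j then (v i : ℂ) else 0) :
    ∫ ω, ‖∑ i, X i ω * A i ω‖ ^ 2 ∂P = ∑ i, v i * ∫ ω, ‖A i ω‖ ^ 2 ∂P := by
  have h3 : ∀ z : ℂ, ((‖z‖ ^ 2 : ℝ) : ℂ) = z * star z := fun z => by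
    simp [Complex.mul_conj, Complex.normSq_eq_norm_sq]
  have hii : ∀ i j, IndepFun (fun ω => X i ω * star (X j ω)) (fun ω => A i ω * star (A j ω)) P :=
    fun i j => hind.comp (φ := fun z : ι → ℂ => z i * star (z j))
      (ψ := fun z : ι → ℂ => z i * star (z j)) (by fun_prop) (by fun_prop)
  have hint : ∀ {Z : ι → Ω → ℂ}, (∀ i, MemLp (Z i) 2 P) → ∀ i j,
      Integrable (fun ω => Z i ω * star (Z j ω)) P := fun hZ i j =>
    integrable_mul_star_of_memLp_two (hZ i) (hZ j)
  apply Complex.ofReal_injective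
  rw [← integral_complex_ofReal]
  have key : ∀ ω, ((‖∑ i, X i ω * A i ω‖ ^ 2 : ℝ) : ℂ) =
      ∑ i, ∑ j, (X i ω * star (X j ω)) * (A i ω * star (A j ω)) := by
    intro ω
    rw [h3, star_sum, Finset.sum_mul]
    refine Finset.sum_congr rfl fun i _ => ?_
    rw [Finset.mul_sum]
    refine Finset.sum_congr rfl fun j _ => ?_
    rw [star_mul']
    ring
  simp_rw [key]
  have hint2 : ∀ i j, Integrable (fun ω => (X i ω * star (X j ω)) * (A i ω * star (A j ω))) P :=
    fun i j => (hii i j).integrable_mul (hint hX i j) (hint hA i j)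
  rw [integral_finsetSum _ fun i _ => integrable_finsetSum _ fun j _ => hint2 i j]
  push_cast
  refine Finset.sum_congr rfl fun i _ => ?_
  rw [integral_finsetSum _ fun j _ => hint2 i j, Finset.sum_eq_single i _ (by simp)]
  · rw [(hii i i).integral_fun_mul_eq_mul_integral (hint hX i i).1 (hint hA i i).1, hv, if_pos rfl,
      ← integral_complex_ofReal]
    simp_rw [h3]
  · intro j _ hj
    rw [(hii i j).integral_fun_mul_eq_mul_integral (hint hX i j).1 (hint hA i j).1, hv,
      if_neg hj.symm, zero_mul]

end Independence

/-! ### Zero-forcing directions and orthogonal complements -/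

section LinearAlgebra

/-- The orthogonal complement, for the Hermitian form `star u ⬝ᵥ v`, of the span of linearly
independent vectors has an orthonormal basis of the expected size. -/
theorem exists_orthonormal_compl {M : ℕ} {κ : Type*} [Fintype κ] {x : κ → Fin M → ℂ}
    (hx : LinearIndependent ℂ x) :
    ∃ b : Fin (M - Fintype.card κ) → Fin M → ℂ,
      (∀ j j', star (b j) ⬝ᵥ b j' = if j = j' then 1 else 0) ∧
      (∀ j i, star (b j) ⬝ᵥ x i = 0) ∧
      ∀ v : Fin M → ℂ, (∀ i, star (x i) ⬝ᵥ v = 0) → v = ∑ j, (star (b j) ⬝ᵥ v) • b j := by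
  let e := WithLp.linearEquiv 2 ℂ (Fin M → ℂ)
  let y : κ → EuclideanSpace ℂ (Fin M) := fun i => WithLp.toLp 2 (x i)
  have hy : LinearIndependent ℂ y :=
    hx.map' e.symm.toLinearMap (LinearMap.ker_eq_bot.2 e.symm.injective)
  let K := Submodule.span ℂ (Set.range y)
  have hK : Module.finrank ℂ K = Fintype.card κ := finrank_span_eq_card hy
  have hKo : Module.finrank ℂ Kᗮ = M - Fintype.card κ := by
    have := K.finrank_add_finrank_orthogonal
    rw [finrank_euclideanSpace_fin] at this
    omega
  have inner_eq : ∀ u v : EuclideanSpace ℂ (Fin M), inner ℂ u v = star u.ofLp ⬝ᵥ v.ofLp := by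
    intro u v
    rw [EuclideanSpace.inner_eq_star_dotProduct, dotProduct_comm]
  let B := (stdOrthonormalBasis ℂ Kᗮ).reindex (finCongr hKo)
  refine ⟨fun j => ((B j : Kᗮ) : EuclideanSpace ℂ (Fin M)).ofLp, ?_, ?_, ?_⟩
  · intro j j'
    rw [← inner_eq, ← Submodule.coe_inner]
    exact orthonormal_iff_ite.1 B.orthonormal j j'
  · intro j i
    have := (B j).2 (y i) (Submodule.subset_span ⟨i, rfl⟩)
    rw [← inner_eq _ (y i), ← inner_conj_symm, this, map_zero]
  · intro v hv
    have hvK : WithLp.toLp 2 v ∈ Kᗮ := by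
      rw [Submodule.mem_orthogonal]
      intro u hu
      induction hu using Submodule.span_induction with
      | mem u hu =>
        obtain ⟨i, rfl⟩ := hu
        rw [inner_eq]
        exact hv i
      | zero => simp
      | add u w _ _ h1 h2 => rw [inner_add_left, h1, h2, add_zero]
      | smul a u _ h => rw [inner_smul_left, h, mul_zero]
    have := B.sum_repr' ⟨_, hvK⟩
    have := congrArg (fun u : Kᗮ => (u : EuclideanSpace ℂ (Fin M)).ofLp) this
    simp only [Submodule.coe_sum, Submodule.coe_smul, Submodule.coe_inner, inner_eq,
      WithLp.ofLp_sum, WithLp.ofLp_smul] at this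
    exact this.symm

open scoped ComplexOrder in
theorem isUnit_conjTranspose_mul_self_of_linearIndependent {m n : ℕ}
    {H : Matrix (Fin m) (Fin n) ℂ} (h : LinearIndependent ℂ H.col) : IsUnit (Hᴴ * H) :=
  (PosDef.conjTranspose_mul_self H (mulVec_injective_iff.2 h)).isUnit

theorem sqNorm_eq_dotProduct {m : ℕ} (v : Fin m → ℂ) : (sqNorm v : ℂ) = star v ⬝ᵥ v := by
  simp [sqNorm, dotProduct, Complex.conj_mul']

/-- The zero-forcing directions `H (Hᴴ H)⁻¹ eᵢ` are dual to the columns of `H`. -/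
theorem star_dotProduct_zeroForcing {m n : ℕ} {H : Matrix (Fin m) (Fin n) ℂ}
    (h : IsUnit (Hᴴ * H)) (i j : Fin n) :
    star (H.col j) ⬝ᵥ ((H * (Hᴴ * H)⁻¹) *ᵥ Pi.single i 1) = if j = i then 1 else 0 := by
  have h1 : Hᴴ * (H * (Hᴴ * H)⁻¹) = 1 := by
    rw [← Matrix.mul_assoc, mul_nonsing_inv _ ((isUnit_iff_isUnit_det _).1 h)]
  have h2 : star (H.col j) ⬝ᵥ ((H * (Hᴴ * H)⁻¹) *ᵥ Pi.single i 1) =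
      (Hᴴ *ᵥ ((H * (Hᴴ * H)⁻¹) *ᵥ Pi.single i 1)) j := rfl
  rw [h2, mulVec_mulVec, h1, one_mulVec, Pi.single_apply]

/-- The squared norm of the `i`-th zero-forcing direction is the inverse of the squared norm of the
projection of the `i`-th column onto the orthogonal complement of the other columns, here computed
in an orthonormal basis `b` of this complement. -/
theorem sqNorm_zeroForcing {m n d : ℕ} {H : Matrix (Fin m) (Fin n) ℂ} (h : IsUnit (Hᴴ * H))
    (i : Fin n) {b : Fin d → Fin m → ℂ}
    (hb : ∀ j l, l ≠ i → star (b j) ⬝ᵥ H.col l = 0)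
    (hc : ∀ v : Fin m → ℂ, (∀ l, l ≠ i → star (H.col l) ⬝ᵥ v = 0) →
      v = ∑ j, (star (b j) ⬝ᵥ v) • b j) :
    sqNorm ((H * (Hᴴ * H)⁻¹) *ᵥ Pi.single i 1) = (∑ j, ‖star (b j) ⬝ᵥ H.col i‖ ^ 2)⁻¹ := by
  set v := (H * (Hᴴ * H)⁻¹) *ᵥ Pi.single i 1 with hv
  have hdual : ∀ l, star (H.col l) ⬝ᵥ v = if l = i then 1 else 0 := star_dotProduct_zeroForcing h i
  have hsum := hc v fun l hl => by rw [hdual, if_neg hl]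
  -- `v` lies in the column span with coordinates `w`; only the `i`-th one meets the complement
  set w := (Hᴴ * H)⁻¹ *ᵥ Pi.single i 1 with hw
  have hvw : v = ∑ l, w l • H.col l := by
    rw [hv, ← mulVec_mulVec, ← hw, mulVec_eq_sum]
    exact Finset.sum_congr rfl fun l _ => op_smul_eq_smul _ _
  have hcoef : ∀ j, star (b j) ⬝ᵥ v = w i * (star (b j) ⬝ᵥ H.col i) := by
    intro j
    rw [hvw, dotProduct_sum, Finset.sum_eq_single i]
    · rw [dotProduct_smul, smul_eq_mul]
    · intro l _ hl
      rw [dotProduct_smul, hb j l hl, smul_zero]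
    · simp
  have hpair : ∀ u : Fin m → ℂ, star u ⬝ᵥ v =
      ∑ j, w i * (star (b j) ⬝ᵥ H.col i) * star (star (b j) ⬝ᵥ u) := by
    intro u
    conv_lhs => rw [hsum]
    rw [dotProduct_sum]
    refine Finset.sum_congr rfl fun j _ => ?_
    rw [dotProduct_smul, smul_eq_mul, hcoef, ← star_dotProduct_star, star_star]
  have h3 : ∀ z : ℂ, z * star z = ((‖z‖ ^ 2 : ℝ) : ℂ) := fun z => by
    simp [Complex.mul_conj, Complex.normSq_eq_norm_sq]
  have h1 : w i * ((∑ j, ‖star (b j) ⬝ᵥ H.col i‖ ^ 2 : ℝ) : ℂ) = 1 := by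
    have := hdual i
    rw [if_pos rfl, hpair] at this
    rw [← this]
    push_cast
    rw [Finset.mul_sum]
    refine Finset.sum_congr rfl fun j _ => ?_
    rw [mul_assoc, h3]
    push_cast
    rfl
  have h2 : (sqNorm v : ℂ) = w i * star (w i) * ((∑ j, ‖star (b j) ⬝ᵥ H.col i‖ ^ 2 : ℝ) : ℂ) := by
    rw [sqNorm_eq_dotProduct, hpair]
    push_cast
    rw [Finset.mul_sum]
    refine Finset.sum_congr rfl fun j _ => ?_
    rw [hcoef, star_mul', ← Complex.ofReal_pow, ← h3]
    ring
  apply Complex.ofReal_injective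
  rw [h2]
  have hS : ((∑ j, ‖star (b j) ⬝ᵥ H.col i‖ ^ 2 : ℝ) : ℂ) ≠ 0 := fun h0 => by simp [h0] at h1
  have hwi : w i = (((∑ j, ‖star (b j) ⬝ᵥ H.col i‖ ^ 2)⁻¹ : ℝ) : ℂ) := by
    rw [Complex.ofReal_inv]
    exact eq_inv_of_mul_eq_one_left h1
  rw [mul_right_comm, h1, one_mul, hwi]
  exact Complex.conj_ofReal _

end LinearAlgebra

/-! ### The inverse moment of a sum of squared moduli -/

section InverseMoment

theorem ofReal_inv_eq_lintegral_exp {x : ℝ} (hx : 0 < x) :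
    ENNReal.ofReal x⁻¹ = ∫⁻ t in Set.Ioi (0 : ℝ), ENNReal.ofReal (Real.exp (-(t * x))) := by
  have h1 := integral_exp_mul_Ioi (a := -x) (by linarith) 0
  have h2 := integrableOn_exp_mul_Ioi (a := -x) (by linarith) 0
  have h3 : ∀ t : ℝ, -(t * x) = -x * t := fun t => by ring
  simp_rw [h3]
  rw [← ofReal_integral_eq_lintegral_ofReal h2
    (Filter.Eventually.of_forall fun t => (Real.exp_pos _).le), h1]
  congr 1
  field_simp
  simp

theorem lintegral_one_div_one_add_mul_pow {s : ℝ} (hs : 0 < s) {n : ℕ} (hn : 0 < n) :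
    ∫⁻ t in Set.Ioi (0 : ℝ), ENNReal.ofReal ((1 / (1 + s * t)) ^ (n + 1)) =
      ENNReal.ofReal (1 / (s * n)) := by
  have hn' : (0 : ℝ) < n := by exact_mod_cast hn
  have hpos : ∀ t ∈ Set.Ici (0 : ℝ), 0 < 1 + s * t := fun t ht => by
    have : 0 ≤ t := ht
    positivity
  -- an explicit primitive, vanishing at infinity
  have hderiv : ∀ t ∈ Set.Ici (0 : ℝ), HasDerivAt (fun t => -(1 / (s * n)) * ((1 + s * t) ^ n)⁻¹)
      ((1 / (1 + s * t)) ^ (n + 1)) t := by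
    intro t ht
    have hp := (hpos t ht).ne'
    have h1 : HasDerivAt (fun t => 1 + s * t) s t := by
      simpa using ((hasDerivAt_id t).const_mul s).const_add 1
    refine (((h1.fun_pow n).fun_inv (pow_ne_zero n hp)).const_mul (-(1 / (s * n)))).congr_deriv ?_
    obtain ⟨m, rfl⟩ : ∃ m, n = m + 1 := ⟨n - 1, by omega⟩
    rw [Nat.add_sub_cancel, _root_.one_div_pow]
    field_simp
    ring
  have hlim : Filter.Tendsto (fun t => -(1 / (s * n)) * ((1 + s * t) ^ n)⁻¹) Filter.atTop
      (nhds 0) := by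
    have h1 : Filter.Tendsto (fun t : ℝ => 1 + s * t) Filter.atTop Filter.atTop :=
      Filter.tendsto_atTop_add_const_left _ _ (Filter.tendsto_id.const_mul_atTop hs)
    have h2 := ((Filter.tendsto_pow_atTop hn.ne').comp h1).inv_tendsto_atTop.const_mul
      (-(1 / (s * n)))
    simpa using h2
  have hnn : ∀ t ∈ Set.Ioi (0 : ℝ), 0 ≤ (1 / (1 + s * t)) ^ (n + 1) := fun t ht => by
    have := hpos t (Set.Ioi_subset_Ici_self ht)
    positivity
  rw [← ofReal_integral_eq_lintegral_ofReal (integrableOn_Ioi_deriv_of_nonneg' hderiv hnn hlim)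
    ((ae_restrict_iff' measurableSet_Ioi).2 (Filter.Eventually.of_forall hnn)),
    integral_Ioi_of_hasDerivAt_of_nonneg' hderiv hnn hlim]
  simp

/-- The inverse moment of a Gamma variable, realized as the sum of the squared moduli of `n + 1`
independent `CN(0, s)` variables: write `x⁻¹ = ∫ e^{-t x} dt` over `t > 0` and use the Laplace
transform `(1 + s t)^{-(n + 1)}`. -/
theorem lintegral_inv_sum_norm_sq {Ω : Type*} [MeasurableSpace Ω] {P : Measure Ω} {s : ℝ≥0}
    (hs : 0 < s) {n : ℕ} (hn : 0 < n) {Z : Fin (n + 1) → Ω → ℂ} (hZ : ∀ j, Measurable (Z j))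
    (hlaw : ∀ j, P.map (Z j) = complexGaussian s) (hind : iIndepFun Z P) :
    ∫⁻ ω, ENNReal.ofReal (∑ j, ‖Z j ω‖ ^ 2)⁻¹ ∂P = ENNReal.ofReal (1 / (s * n)) := by
  have := hind.isProbabilityMeasure
  have hpos : ∀ᵐ ω ∂P, 0 < ∑ j, ‖Z j ω‖ ^ 2 := by
    have h0 : ∀ᵐ ω ∂P, Z 0 ω ≠ 0 := by
      have := complexGaussian_singleton_zero hs
      rw [← hlaw 0, Measure.map_apply (hZ 0) (measurableSet_singleton 0)] at this
      exact measure_eq_zero_iff_ae_notMem.1 this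
    filter_upwards [h0] with ω hω
    exact Finset.sum_pos' (fun j _ => by positivity) ⟨0, Finset.mem_univ _, by positivity⟩
  have h1 : ∫⁻ ω, ENNReal.ofReal (∑ j, ‖Z j ω‖ ^ 2)⁻¹ ∂P =
      ∫⁻ ω, (∫⁻ t in Set.Ioi (0 : ℝ), ENNReal.ofReal (Real.exp (-(t * ∑ j, ‖Z j ω‖ ^ 2)))) ∂P :=
    lintegral_congr_ae (hpos.mono fun ω hω => ofReal_inv_eq_lintegral_exp hω)
  rw [h1, lintegral_lintegral_swap (by fun_prop),
    ← lintegral_one_div_one_add_mul_pow (NNReal.coe_pos.2 hs) hn]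
  refine setLIntegral_congr_fun measurableSet_Ioi fun t ht => ?_
  have ht0 : 0 ≤ t := le_of_lt ht
  have h2 : ∀ ω, ENNReal.ofReal (Real.exp (-(t * ∑ j, ‖Z j ω‖ ^ 2))) =
      ∏ j, ENNReal.ofReal (Real.exp (-(t * ‖Z j ω‖ ^ 2))) := by
    intro ω
    rw [← ENNReal.ofReal_prod_of_nonneg fun j _ => (Real.exp_pos _).le, ← Real.exp_sum,
      Finset.mul_sum, Finset.sum_neg_distrib]
  simp_rw [h2]
  rw [lintegral_prod_eq_prod_lintegral_of_indepFun Finset.univ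
    (fun j ω => ENNReal.ofReal (Real.exp (-(t * ‖Z j ω‖ ^ 2))))
    (hind.comp (fun _ z => ENNReal.ofReal (Real.exp (-(t * ‖z‖ ^ 2)))) fun _ => by fun_prop)
    fun j => by have := hZ j; fun_prop]
  have h3 : ∀ j, ∫⁻ ω, ENNReal.ofReal (Real.exp (-(t * ‖Z j ω‖ ^ 2))) ∂P =
      ENNReal.ofReal (1 / (1 + s * t)) := by
    intro j
    rw [← lintegral_exp_neg_mul_norm_sq_complexGaussian hs ht0, ← hlaw j,
      lintegral_map (by fun_prop) (hZ j)]
  simp_rw [h3]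
  rw [Finset.prod_const, Finset.card_univ, Fintype.card_fin, ENNReal.ofReal_pow (by positivity)]

end InverseMoment

/-! ### Gaussian matrices with independent columns -/

section GaussianMatrix

/-- Replacing one coordinate of a family with independent coordinates by an independent copy does
not change the law. This is what allows conditioning on all the other coordinates. -/
theorem measurePreserving_update {ι : Type*} [Fintype ι] [DecidableEq ι] {α : ι → Type*}
    [∀ i, MeasurableSpace (α i)] (μ : ∀ i, Measure (α i)) [∀ i, IsProbabilityMeasure (μ i)]
    (i : ι) :
    MeasurePreserving (fun p : (∀ i, α i) × α i => Function.update p.1 i p.2)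
      ((Measure.pi μ).prod (μ i)) (Measure.pi μ) := by
  have hm : Measurable fun p : (∀ i, α i) × α i => Function.update p.1 i p.2 := by
    refine measurable_pi_lambda _ fun j => ?_
    by_cases h : j = i
    · subst h; simpa using measurable_snd
    · simpa [h, Function.comp_def] using
        (measurable_pi_apply (X := α) j).comp (measurable_fst (β := α i))
  refine ⟨hm, (Measure.pi_eq fun s hs => ?_).symm⟩
  rw [Measure.map_apply hm (.univ_pi hs)]
  have : (fun p : (∀ i, α i) × α i => Function.update p.1 i p.2) ⁻¹' Set.univ.pi s =
      (Set.univ.pi (Function.update s i Set.univ)) ×ˢ s i := by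
    ext p
    simp only [Set.mem_preimage, Set.mem_univ_pi, Set.mem_prod]
    constructor
    · intro h
      refine ⟨fun j => ?_, by simpa using h i⟩
      by_cases hj : j = i
      · subst hj; simp
      · simpa [hj] using h j
    · rintro ⟨h1, h2⟩ j
      by_cases hj : j = i
      · subst hj; simpa using h2
      · simpa [hj] using h1 j
  rw [this, Measure.prod_prod, Measure.pi_pi, ← Finset.prod_erase_mul _ _ (Finset.mem_univ i),
    ← Finset.prod_erase_mul _ (fun j => μ j (s j)) (Finset.mem_univ i)]
  congr 1
  rw [Function.update_self, measure_univ, mul_one]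
  refine Finset.prod_congr rfl fun j hj => ?_
  rw [Function.update_of_ne (Finset.ne_of_mem_erase hj)]

/-- The coordinates of a vector with independent `CN(0, s)` entries in an orthonormal family. -/
theorem iIndepFun_orthonormal_coords {M d : ℕ} (s : ℝ≥0) {b : Fin d → Fin M → ℂ}
    (hb : ∀ j j', star (b j) ⬝ᵥ b j' = if j = j' then 1 else 0) :
    iIndepFun (fun j (z : Fin M → ℂ) => star (b j) ⬝ᵥ z)
        (Measure.pi fun _ : Fin M => complexGaussian s) ∧
      ∀ j, (Measure.pi fun _ : Fin M => complexGaussian s).map (fun z => star (b j) ⬝ᵥ z) =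
        complexGaussian s := by
  have hX : ∀ m : Fin M, Measurable fun z : Fin M → ℂ => z m := measurable_pi_apply
  have hind : iIndepFun (fun (m : Fin M) (z : Fin M → ℂ) => z m)
      (Measure.pi fun _ : Fin M => complexGaussian s) :=
    iIndepFun_pi (X := fun _ z => z) fun _ => aemeasurable_id
  have hlaw : ∀ m : Fin M, (Measure.pi fun _ : Fin M => complexGaussian s).map (fun z => z m) =
      complexGaussian s := fun m =>
    (measurePreserving_eval (fun _ : Fin M => complexGaussian s) m).map_eq
  constructor
  · refine iIndepFun_linearForms hX hlaw hind (fun j m => star (b j m)) fun j j' hne => ?_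
    rw [← Finset.mul_sum]
    have := hb j j'
    rw [if_neg hne] at this
    simp_rw [star_star]
    rw [show ∑ i, star (b j i) * b j' i = star (b j) ⬝ᵥ b j' from rfl, this, mul_zero]
  · intro j
    have := map_linearForm_eq_complexGaussian hX hlaw hind fun m => star (b j m)
    refine this.trans ?_
    congr 1
    rw [← Finset.mul_sum]
    have h1 : ∑ m, ‖star (b j m)‖₊ ^ 2 = 1 := by
      have h2 := hb j j
      rw [if_pos rfl, ← sqNorm_eq_dotProduct] at h2
      have h3 : sqNorm (b j) = 1 := by exact_mod_cast h2
      apply NNReal.coe_injective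
      push_cast
      simpa [sqNorm] using h3
    rw [h1, mul_one]

/-- A vector with independent complex Gaussian entries almost surely avoids a given proper
subspace. -/
theorem ae_notMem_span {M : ℕ} {s : ℝ≥0} (hs : 0 < s) {κ : Type*} [Fintype κ]
    {x : κ → Fin M → ℂ} (hx : LinearIndependent ℂ x) (hcard : Fintype.card κ < M) :
    ∀ᵐ z ∂(Measure.pi fun _ : Fin M => complexGaussian s),
      z ∉ Submodule.span ℂ (Set.range x) := by
  obtain ⟨b, hb, hbx, -⟩ := exists_orthonormal_compl hx
  let j : Fin (M - Fintype.card κ) := ⟨0, by omega⟩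
  have hm : Measurable fun z : Fin M → ℂ => star (b j) ⬝ᵥ z := by
    unfold dotProduct
    fun_prop
  have h0 := complexGaussian_singleton_zero hs
  rw [← (iIndepFun_orthonormal_coords s hb).2 j, Measure.map_apply hm (measurableSet_singleton 0)]
    at h0
  filter_upwards [measure_eq_zero_iff_ae_notMem.1 h0] with z hz hmem
  refine hz (show star (b j) ⬝ᵥ z = 0 from ?_)
  clear hz
  induction hmem using Submodule.span_induction with
  | mem u hu => obtain ⟨i, rfl⟩ := hu; exact hbx j i
  | zero => simp
  | add u w _ _ h1 h2 => rw [dotProduct_add, h1, h2, add_zero]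
  | smul a u _ h => rw [dotProduct_smul, h, smul_zero]

/-- Law of the family of columns of a matrix with independent entries, the entries of the `i`-th
column being `CN(0, s i)`. -/
def gaussianColumns (M : ℕ) {n : ℕ} (s : Fin n → ℝ≥0) : Measure (Fin n → Fin M → ℂ) :=
  Measure.pi fun i => Measure.pi fun _ : Fin M => complexGaussian (s i)

instance isProbabilityMeasure_gaussianColumns (M : ℕ) {n : ℕ} (s : Fin n → ℝ≥0) :
    IsProbabilityMeasure (gaussianColumns M s) := by
  unfold gaussianColumns
  infer_instance

theorem measurableSet_linearIndepOn {M n : ℕ} (S : Finset (Fin n)) :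
    MeasurableSet {x : Fin n → Fin M → ℂ | LinearIndepOn ℂ x (S : Set (Fin n))} :=
  (isOpen_setOfPred_linearIndependent.preimage
    (by fun_prop : Continuous fun (x : Fin n → Fin M → ℂ) (i : (S : Set (Fin n))) =>
      x i)).measurableSet

/-- By induction on the set of columns: each column avoids the span of the earlier ones. -/
theorem ae_linearIndepOn_gaussianColumns {M n : ℕ} {s : Fin n → ℝ≥0} (hs : ∀ i, 0 < s i)
    (S : Finset (Fin n)) (hS : S.card ≤ M) :
    ∀ᵐ x ∂gaussianColumns M s, LinearIndepOn ℂ x (S : Set (Fin n)) := by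
  induction S using Finset.induction_on with
  | empty => simp
  | insert i S hi ih =>
    rw [Finset.card_insert_of_notMem hi] at hS
    -- resample the `i`-th column: this does not change the law
    have hmp := measurePreserving_update
      (fun i => Measure.pi fun _ : Fin M => complexGaussian (s i)) i
    have hmeas := measurableSet_linearIndepOn (M := M) (insert i S)
    rw [gaussianColumns, ← hmp.map_eq, ae_map_iff hmp.measurable.aemeasurable hmeas]
    refine (Measure.ae_prod_iff_ae_ae (hmp.measurable hmeas)).2 ?_
    filter_upwards [ih (by omega)] with x hx
    have hx' : LinearIndependent ℂ fun j : (S : Set (Fin n)) => x j := hx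
    filter_upwards [ae_notMem_span (hs i) hx' (by simpa using hS)] with z hz
    have heq : Set.EqOn (Function.update x i z) x (S : Set (Fin n)) := fun j hj =>
      Function.update_of_ne (fun h => hi (by simpa [h] using hj)) _ _
    rw [Finset.coe_insert, linearIndepOn_insert (by simpa using hi), linearIndepOn_congr heq,
      Function.update_self, heq.image_eq]
    refine ⟨hx, ?_⟩
    rwa [Set.image_eq_range]

theorem ae_linearIndependent_gaussianColumns {M n : ℕ} {s : Fin n → ℝ≥0} (hs : ∀ i, 0 < s i)
    (hn : n ≤ M) : ∀ᵐ x ∂gaussianColumns M s, LinearIndependent ℂ x := by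
  filter_upwards [ae_linearIndepOn_gaussianColumns hs Finset.univ (by simpa using hn)] with x hx
  rwa [Finset.coe_univ, linearIndepOn_univ_iff] at hx

theorem measurable_det_of_entries {Ω : Type*} {_ : MeasurableSpace Ω} {n : ℕ}
    {A : Ω → Matrix (Fin n) (Fin n) ℂ} (hA : ∀ i j, Measurable fun ω => A ω i j) :
    Measurable fun ω => (A ω).det := by
  simp_rw [det_apply]
  exact Finset.measurable_sum _ fun σ _ =>
    (Finset.measurable_prod _ fun i _ => hA _ _).const_smul _

theorem measurable_inv_of_entries {Ω : Type*} {_ : MeasurableSpace Ω} {n : ℕ}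
    {A : Ω → Matrix (Fin n) (Fin n) ℂ} (hA : ∀ i j, Measurable fun ω => A ω i j) (i j : Fin n) :
    Measurable fun ω => (A ω)⁻¹ i j := by
  simp_rw [Matrix.inv_def, Matrix.smul_apply, Ring.inverse_eq_inv', adjugate_apply]
  refine (measurable_det_of_entries hA).inv.smul (measurable_det_of_entries fun k l => ?_)
  by_cases h : k = j
  · subst h; simp
  · simpa [updateRow_apply, h] using hA k l

/-- The `i`-th zero-forcing direction `H (Hᴴ H)⁻¹ eᵢ`. -/
def zeroForcing {m n : ℕ} (H : Matrix (Fin m) (Fin n) ℂ) (i : Fin n) : Fin m → ℂ :=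
  (H * (Hᴴ * H)⁻¹) *ᵥ Pi.single i 1

theorem measurable_zeroForcing {Ω : Type*} {_ : MeasurableSpace Ω} {m n : ℕ}
    {H : Ω → Matrix (Fin m) (Fin n) ℂ} (hH : ∀ i j, Measurable fun ω => H ω i j) (i : Fin n)
    (j : Fin m) : Measurable fun ω => zeroForcing (H ω) i j := by
  have h1 : ∀ k l, Measurable fun ω => ((H ω)ᴴ * H ω) k l := fun k l => by
    simp only [mul_apply, conjTranspose_apply]
    exact Finset.measurable_sum _ fun x _ =>
      ((by fun_prop : Measurable fun z : ℂ => star z).comp (hH _ _)).mul (hH _ _)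
  simp only [zeroForcing, mulVec_single_one, col_apply, mul_apply]
  exact Finset.measurable_sum _ fun x _ => (hH _ _).mul (measurable_inv_of_entries h1 _ _)

theorem measurable_sqNorm {m : ℕ} : Measurable (sqNorm : (Fin m → ℂ) → ℝ) := by
  unfold sqNorm
  fun_prop

/-- Mean square norm of a zero-forcing direction, that is the inverse moment of the complex Wishart
law: given the other columns, its square norm is the inverse of a sum of `M - n + 1` squared
moduli of independent `CN(0, s i)` variables. -/
theorem lintegral_sqNorm_zeroForcing {M n : ℕ} {s : Fin n → ℝ≥0} (hs : ∀ i, 0 < s i) (hn : n < M)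
    (i : Fin n) :
    ∫⁻ x, ENNReal.ofReal (sqNorm (zeroForcing (Matrix.of x)ᵀ i)) ∂gaussianColumns M s =
      ENNReal.ofReal (1 / (s i * (M - n))) := by
  have hmp := measurePreserving_update
    (fun i => Measure.pi fun _ : Fin M => complexGaussian (s i)) i
  have hF : Measurable fun x : Fin n → Fin M → ℂ =>
      ENNReal.ofReal (sqNorm (zeroForcing (Matrix.of x)ᵀ i)) := by
    refine ENNReal.measurable_ofReal.comp (measurable_sqNorm.comp (measurable_pi_lambda _ ?_))
    intro j
    refine measurable_zeroForcing (fun k l => ?_) i j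
    exact (measurable_pi_apply k).comp (measurable_pi_apply l)
  have hli := ae_linearIndependent_gaussianColumns hs hn.le
  -- resample the `i`-th column and integrate it first, the other columns being fixed
  have hli2 : ∀ᵐ x ∂gaussianColumns M s, ∀ᵐ z ∂(Measure.pi fun _ : Fin M => complexGaussian (s i)),
      LinearIndependent ℂ (Function.update x i z) := by
    exact Measure.ae_ae_of_ae_prod (hmp.quasiMeasurePreserving.ae hli)
  conv_lhs => rw [gaussianColumns]
  rw [← hmp.map_eq, lintegral_map hF hmp.measurable]
  refine (lintegral_prod _ (hF.comp hmp.measurable).aemeasurable).trans ?_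
  rw [← gaussianColumns]
  have hconst : ∀ᵐ x ∂gaussianColumns M s,
      ∫⁻ z, ENNReal.ofReal (sqNorm (zeroForcing (Matrix.of (Function.update x i z))ᵀ i))
        ∂(Measure.pi fun _ : Fin M => complexGaussian (s i)) =
      ENNReal.ofReal (1 / (s i * (M - n))) := by
    filter_upwards [hli, hli2] with x hx hx2
    have hx' : LinearIndependent ℂ fun j : {j // j ≠ i} => x j :=
      hx.comp _ Subtype.val_injective
    obtain ⟨b, hb, hbx, hbc⟩ := exists_orthonormal_compl hx'
    have hcard : Fintype.card {j // j ≠ i} = n - 1 := by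
      rw [Fintype.card_subtype_compl, Fintype.card_fin, Fintype.card_subtype_eq]
    have hi := i.2
    have hdim : M - Fintype.card {j // j ≠ i} = (M - n) + 1 := by omega
    -- rewriting the dimension to a successor needs it free in the type of `b`
    generalize M - Fintype.card {j // j ≠ i} = d at b hb hbx hbc hdim
    subst hdim
    obtain ⟨hind, hlaw⟩ := iIndepFun_orthonormal_coords (s i) hb
    have hmain := lintegral_inv_sum_norm_sq (hs i) (n := M - n) (by omega)
      (fun j => by unfold dotProduct; fun_prop) hlaw hind
    rw [Nat.cast_sub hn.le] at hmain
    rw [← hmain]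
    refine lintegral_congr_ae ?_
    filter_upwards [hx2] with z hz
    have hcol : ∀ l, (Matrix.of (Function.update x i z))ᵀ.col l = Function.update x i z l :=
      fun l => rfl
    have hunit := isUnit_conjTranspose_mul_self_of_linearIndependent
      (H := (Matrix.of (Function.update x i z))ᵀ) hz
    rw [zeroForcing, sqNorm_zeroForcing hunit i (b := b)]
    · simp_rw [hcol, Function.update_self]
    · intro j l hl
      rw [hcol, Function.update_of_ne hl]
      exact hbx j ⟨l, hl⟩
    · intro v hv
      refine hbc v fun l => ?_
      have := hv l.1 l.2
      rwa [hcol, Function.update_of_ne l.2] at this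
  refine (lintegral_congr_ae hconst).trans ?_
  simp

end GaussianMatrix

/-! ### Pilot projections as linear forms in the random sources -/

namespace SwiptParams

variable {M N KI KE τI τE : ℕ} (D : SwiptParams M N KI KE τI τE)

/-- Variances of the sources seen by one antenna in the IU pilot projections: the small-scale
fading of each IU and the noise of each pilot symbol. -/
def sourceVar : Fin KI ⊕ Fin (τI + τE) → ℝ≥0 := Sum.elim (fun _ => 1) fun _ => D.σ2

/-- Coefficients of the `i`-th IU pilot projection in the sources of one antenna. -/
def pilotCoef (i : Fin τI) : Fin KI ⊕ Fin (τI + τE) → ℂ :=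
  Sum.elim (fun k => if D.iI k = i then (√D.τp * √(D.βBI k) : ℂ) else 0) (D.φI i)

/-- Coefficients of the error `h_k - c_{h_k} y_k` of the channel estimate of IU `k`. -/
def errCoef (k : Fin KI) (j : Fin KI ⊕ Fin (τI + τE)) : ℂ :=
  (Pi.single (Sum.inl k) (√(D.βBI k) : ℂ) : _ → ℂ) j - D.cH k * D.pilotCoef (D.iI k) j

/-- Variance of each entry of the `i`-th IU pilot projection. -/
def pilotPower (i : Fin τI) : ℝ := D.τp * (∑ k with D.iI k = i, D.βBI k) + D.σ2

theorem pilotPower_pos (i : Fin τI) : 0 < D.pilotPower i := by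
  have h1 : 0 ≤ D.τp := mul_nonneg (Nat.cast_nonneg _) D.p_pos.le
  have h2 : 0 ≤ ∑ k with D.iI k = i, D.βBI k := Finset.sum_nonneg fun k _ => (D.βBI_pos k).le
  have h3 : (0 : ℝ) < D.σ2 := D.σ2_pos
  have := mul_nonneg h1 h2
  unfold pilotPower
  linarith

theorem τp_nonneg : 0 ≤ D.τp := mul_nonneg (Nat.cast_nonneg _) D.p_pos.le

theorem φEI_orth (j : Fin τE) (i : Fin τI) : star (D.φE j) ⬝ᵥ D.φI i = 0 := by
  rw [← star_star (D.φI i), star_dotProduct_star, dotProduct_comm,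
    dotProduct_comm (D.φE j), D.φIE_orth, star_zero]

theorem cH_eq (k : Fin KI) : D.cH k = √D.τp * D.βBI k / D.pilotPower (D.iI k) := by
  rw [cH, pilotPower]
  congr 2
  simp only [D.φI_orth, D.φEI_orth, norm_zero]
  rw [Finset.sum_filter]
  simp only [ne_eq, OfNat.ofNat_ne_zero, not_false_eq_true, zero_pow, mul_zero,
    Finset.sum_const_zero, add_zero]
  congr 1
  refine Finset.sum_congr rfl fun k' _ => ?_
  split_ifs <;> simp

theorem cH_mul_pilotPower (k : Fin KI) :
    D.cH k * D.pilotPower (D.iI k) = √D.τp * D.βBI k := by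
  rw [cH_eq, div_mul_cancel₀ _ (D.pilotPower_pos _).ne']

theorem γH_eq (k : Fin KI) : D.γH k = D.cH k ^ 2 * D.pilotPower (D.iI k) := by
  rw [sq, mul_assoc, cH_mul_pilotPower, γH]
  ring

theorem sum_sourceVar_pilotCoef (i i' : Fin τI) :
    ∑ j, ((D.sourceVar j : ℝ) : ℂ) * (D.pilotCoef i j * star (D.pilotCoef i' j)) =
      if i = i' then (D.pilotPower i : ℂ) else 0 := by
  have h1 : ∀ k, (√D.τp * √(D.βBI k) : ℂ) * star (√D.τp * √(D.βBI k) : ℂ) =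
      ((D.τp * D.βBI k : ℝ) : ℂ) := by
    intro k
    rw [← Complex.ofReal_mul, ← Real.sqrt_mul D.τp_nonneg]
    simp only [Complex.star_def, Complex.conj_ofReal]
    rw [← Complex.ofReal_mul, Real.mul_self_sqrt (mul_nonneg D.τp_nonneg (D.βBI_pos k).le)]
  have h2 : ∑ s, D.φI i s * star (D.φI i' s) = if i = i' then 1 else 0 := by
    have := D.φI_orth i' i
    rw [dotProduct] at this
    simp_rw [eq_comm (a := i), ← this]
    exact Finset.sum_congr rfl fun s _ => mul_comm _ _
  rw [Fintype.sum_sum_type]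
  simp only [sourceVar, pilotCoef, Sum.elim_inl, Sum.elim_inr, ← Finset.mul_sum, h2]
  by_cases h : i = i'
  · subst h
    simp only [if_true, pilotPower]
    push_cast
    rw [mul_one, one_mul, Finset.mul_sum, Finset.sum_filter]
    congr 1
    refine Finset.sum_congr rfl fun k _ => ?_
    split_ifs
    · rw [h1]; push_cast; ring
    · simp
  · simp only [if_neg h, mul_zero, add_zero]
    rw [Finset.sum_eq_zero, mul_zero]
    intro k _
    by_cases hk : D.iI k = i
    · simp [hk, h]
    · simp [hk]

theorem sum_single_mul {ι : Type*} [Fintype ι] [DecidableEq ι] (v : ι → ℂ) (j₀ : ι) (a : ℂ)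
    (c : ι → ℂ) : ∑ j, v j * ((Pi.single j₀ a : ι → ℂ) j * c j) = v j₀ * (a * c j₀) := by
  rw [Finset.sum_eq_single j₀]
  · simp
  · intro j _ hj; simp [hj]
  · simp

/-- The estimation error of IU `k` is uncorrelated with all IU pilot projections: this is the
choice of the coefficient `c_{h_k}`. -/
theorem sum_sourceVar_errCoef_pilotCoef (k : Fin KI) (i : Fin τI) :
    ∑ j, ((D.sourceVar j : ℝ) : ℂ) * (D.errCoef k j * star (D.pilotCoef i j)) = 0 := by
  have h1 : ∀ j, ((D.sourceVar j : ℝ) : ℂ) * (D.errCoef k j * star (D.pilotCoef i j)) =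
      ((D.sourceVar j : ℝ) : ℂ) * ((Pi.single (Sum.inl k) (√(D.βBI k) : ℂ) : _ → ℂ) j *
        star (D.pilotCoef i j)) - D.cH k *
        (((D.sourceVar j : ℝ) : ℂ) * (D.pilotCoef (D.iI k) j * star (D.pilotCoef i j))) := by
    intro j
    rw [errCoef]
    ring
  simp_rw [h1]
  rw [Finset.sum_sub_distrib, ← Finset.mul_sum, sum_sourceVar_pilotCoef, sum_single_mul]
  by_cases h : D.iI k = i
  · subst h
    rw [if_pos rfl, ← Complex.ofReal_mul, cH_mul_pilotPower]
    simp only [sourceVar, pilotCoef, Sum.elim_inl, if_true, star_mul', Complex.star_def,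
      Complex.conj_ofReal]
    rw [sub_eq_zero]
    norm_cast
    have := Real.mul_self_sqrt (D.βBI_pos k).le
    linear_combination √D.τp * this
  · simp [sourceVar, pilotCoef, h]

theorem sum_sourceVar_errCoef (k : Fin KI) :
    ∑ j, ((D.sourceVar j : ℝ) : ℂ) * (D.errCoef k j * star (D.errCoef k j)) =
      ((D.βBI k - D.γH k : ℝ) : ℂ) := by
  have h1 : ∀ j, ((D.sourceVar j : ℝ) : ℂ) * (D.errCoef k j * star (D.errCoef k j)) =
      ((D.sourceVar j : ℝ) : ℂ) * ((Pi.single (Sum.inl k) (√(D.βBI k) : ℂ) : _ → ℂ) j *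
        star (D.errCoef k j)) - D.cH k *
        star (((D.sourceVar j : ℝ) : ℂ) *
          (D.errCoef k j * star (D.pilotCoef (D.iI k) j))) := by
    intro j
    have h2 : D.errCoef k j * star (D.errCoef k j) =
        ((Pi.single (Sum.inl k) (√(D.βBI k) : ℂ) : _ → ℂ) j -
          D.cH k * D.pilotCoef (D.iI k) j) * star (D.errCoef k j) := rfl
    rw [h2]
    simp only [star_mul', Complex.star_def, Complex.conj_ofReal, Complex.conj_conj]
    ring
  simp_rw [h1]
  rw [Finset.sum_sub_distrib, ← Finset.mul_sum, ← star_sum, sum_sourceVar_errCoef_pilotCoef,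
    sum_single_mul, star_zero, mul_zero, sub_zero, γH]
  simp only [errCoef, sourceVar, pilotCoef, Sum.elim_inl, if_true, Pi.single_eq_same, star_sub,
    star_mul', Complex.star_def, Complex.conj_ofReal]
  norm_cast
  have := Real.mul_self_sqrt (D.βBI_pos k).le
  linear_combination (1 - √D.τp * D.cH k) * this

theorem sum_sourceVar_nnnorm_sq (c : Fin KI ⊕ Fin (τI + τE) → ℂ) :
    (((∑ j, D.sourceVar j * ‖c j‖₊ ^ 2 : ℝ≥0) : ℝ) : ℂ) =
      ∑ j, ((D.sourceVar j : ℝ) : ℂ) * (c j * star (c j)) := by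
  push_cast
  refine Finset.sum_congr rfl fun j _ => ?_
  simp [Complex.mul_conj, Complex.normSq_eq_norm_sq]

/-- Variance of each entry of the `i`-th IU pilot projection, as a parameter of the complex
Gaussian law; `coe_pilotVar` gives its closed form. -/
def pilotVar (i : Fin τI) : ℝ≥0 := ∑ j, D.sourceVar j * ‖D.pilotCoef i j‖₊ ^ 2

/-- Variance of each entry of the estimation error of IU `k`, as a parameter of the complex
Gaussian law; `coe_errVar` gives its closed form. -/
def errVar (k : Fin KI) : ℝ≥0 := ∑ j, D.sourceVar j * ‖D.errCoef k j‖₊ ^ 2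

theorem coe_pilotVar (i : Fin τI) : (D.pilotVar i : ℝ) = D.pilotPower i := by
  have := D.sum_sourceVar_nnnorm_sq (D.pilotCoef i)
  rw [sum_sourceVar_pilotCoef, if_pos rfl] at this
  exact_mod_cast this

theorem pilotVar_pos (i : Fin τI) : 0 < D.pilotVar i := by
  rw [← NNReal.coe_pos, coe_pilotVar]
  exact D.pilotPower_pos i

theorem coe_errVar (k : Fin KI) : (D.errVar k : ℝ) = D.βBI k - D.γH k := by
  have := D.sum_sourceVar_nnnorm_sq (D.errCoef k)
  rw [sum_sourceVar_errCoef] at this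
  exact_mod_cast this

end SwiptParams

namespace SwiptModel

variable {M N KI KE τI τE : ℕ} {Ω : Type*} [mΩ : MeasurableSpace Ω] {P : Measure Ω}
  (D : SwiptModel M N KI KE τI τE P)

theorem Yp_mulVec (φ : Fin (τI + τE) → ℂ) (ω : Ω) :
    D.Yp ω *ᵥ φ =
      (√D.τp : ℂ) • (∑ l, (star (D.φE (D.iE l)) ⬝ᵥ φ) • D.g l ω) +
      (√D.τp : ℂ) • (∑ k, (star (D.φI (D.iI k)) ⬝ᵥ φ) • D.h k ω) +
      (Matrix.of fun m s => D.Nul (m, s) ω) *ᵥ φ := by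
  simp only [Yp, add_mulVec, smul_mulVec, sum_mulVec, vecMulVec_mulVec, op_smul_eq_smul]

/-- The sources of the IU pilot projections, one row per antenna. -/
def source : (Fin KI ⊕ Fin (τI + τE)) × Fin M → Ω → ℂ :=
  fun j => Sum.elim (fun k => D.hTilde (k, j.2)) (fun s => D.Nul (j.2, s)) j.1

theorem H1_apply (ω : Ω) (m : Fin M) (i : Fin τI) :
    D.H1 ω m i = ∑ j, D.pilotCoef i j * D.source (j, m) ω := by
  have h0 : D.H1 ω m i = (D.Yp ω *ᵥ D.φI i) m := rfl
  rw [h0, Yp_mulVec, Fintype.sum_sum_type]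
  simp only [D.φEI_orth, D.φI_orth, zero_smul, Finset.sum_const_zero, smul_zero, zero_add]
  simp only [Pi.add_apply, Pi.smul_apply, Finset.sum_apply, SwiptParams.pilotCoef, source,
    Sum.elim_inl, Sum.elim_inr, smul_eq_mul, h, mulVec, dotProduct, Matrix.of_apply, Finset.mul_sum]
  congr 1
  · refine Finset.sum_congr rfl fun k _ => ?_
    split_ifs <;> simp [mul_assoc]
  · exact Finset.sum_congr rfl fun s _ => mul_comm _ _

/-- Error `h_k - c_{h_k} y_k` of the channel estimate of IU `k`. -/
def err (k : Fin KI) (ω : Ω) : Fin M → ℂ := fun m => D.h k ω m - D.cH k * D.H1 ω m (D.iI k)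

theorem err_apply (k : Fin KI) (ω : Ω) (m : Fin M) :
    D.err k ω m = ∑ j, D.errCoef k j * D.source (j, m) ω := by
  simp only [err, SwiptParams.errCoef, sub_mul, Finset.sum_sub_distrib, mul_assoc]
  rw [← Finset.mul_sum, ← H1_apply]
  have := SwiptParams.sum_single_mul (fun _ => 1) (Sum.inl k : Fin KI ⊕ Fin (τI + τE))
    (√(D.βBI k) : ℂ) fun j => D.source (j, m) ω
  simp only [one_mul] at this
  rw [this]
  rfl

theorem g_apply (l : Fin KE) (ω : Ω) (m : Fin M) :
    D.g l ω m = D.gbar l m + (√(D.lam l) : ℂ) *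
      ∑ n, (D.Θ *ᵥ D.f l) n * D.H2Tilde (m, n) ω := by
  simp only [g, Pi.add_apply, Pi.smul_apply, smul_eq_mul, mulVec, dotProduct, Matrix.of_apply]
  congr 2
  exact Finset.sum_congr rfl fun n _ => mul_comm _ _

theorem yE_apply (l : Fin KE) (ω : Ω) (m : Fin M) :
    D.yE l ω m = (√D.τp : ℂ) * (∑ l', (star (D.φE (D.iE l')) ⬝ᵥ D.φE (D.iE l)) * D.g l' ω m) +
      ∑ s, D.φE (D.iE l) s * D.Nul (m, s) ω := by
  rw [yE, Yp_mulVec]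
  simp only [D.φIE_orth, zero_smul, Finset.sum_const_zero, smul_zero, add_zero,
    Pi.add_apply, Pi.smul_apply, Finset.sum_apply, smul_eq_mul]
  congr 1
  simp only [mulVec, dotProduct, Matrix.of_apply]
  exact Finset.sum_congr rfl fun s _ => mul_comm _ _

theorem gHat_apply (l : Fin KE) (ω : Ω) (m : Fin M) :
    D.gHat l ω m =
      (∑ m', (covMat P (D.g l) (D.yE l) * (covMat P (D.yE l) (D.yE l))⁻¹) m m' *
        (D.yE l ω m' - meanVec P (D.yE l) m')) + meanVec P (D.g l) m := rfl

theorem gHatScalar_apply (l : Fin KE) (ω : Ω) (m : Fin M) :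
    D.gHatScalar l ω m =
      D.cG l * (D.yE l ω m - ((√D.τp : ℂ) •
        ∑ l', (star (D.φE (D.iE l')) ⬝ᵥ D.φE (D.iE l)) • D.gbar l') m) + D.gbar l m := rfl

/-! ### Dependence of the random quantities on the sources -/

section Measurability

-- `m₀` is any sigma-algebra that makes the sources measurable, so that the same lemmas give
-- measurability and dependence on part of the sources
variable {M N KI KE τI τE : ℕ} {Ω : Type*} {m₀ : MeasurableSpace Ω} [mΩ : MeasurableSpace Ω]
  {P : Measure Ω} (D : SwiptModel M N KI KE τI τE P)

theorem measurable_h (hh : ∀ i, Measurable[m₀] (D.hTilde i)) (k : Fin KI) (m : Fin M) :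
    Measurable[m₀] fun ω => D.h k ω m :=
  (hh (k, m)).const_mul _

theorem measurable_g (hH : ∀ i, Measurable[m₀] (D.H2Tilde i)) (l : Fin KE) (m : Fin M) :
    Measurable[m₀] fun ω => D.g l ω m := by
  simp only [g_apply]
  exact ((Finset.measurable_sum _ fun n _ => (hH (m, n)).const_mul _).const_mul _).const_add _

theorem measurable_sum_mul_g (hH : ∀ i, Measurable[m₀] (D.H2Tilde i)) (a : Fin KE → ℂ)
    (m : Fin M) : Measurable[m₀] fun ω => (√D.τp : ℂ) * ∑ l, a l * D.g l ω m :=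
  (Finset.measurable_sum _ fun l _ => (D.measurable_g hH l m).const_mul _).const_mul _

theorem measurable_yE (hH : ∀ i, Measurable[m₀] (D.H2Tilde i))
    (hN : ∀ i, Measurable[m₀] (D.Nul i)) (l : Fin KE) (m : Fin M) :
    Measurable[m₀] fun ω => D.yE l ω m := by
  simp only [yE_apply]
  exact (D.measurable_sum_mul_g hH _ m).add
    (Finset.measurable_sum _ fun s _ => (hN (m, s)).const_mul _)

theorem measurable_gHat (hH : ∀ i, Measurable[m₀] (D.H2Tilde i))
    (hN : ∀ i, Measurable[m₀] (D.Nul i)) (l : Fin KE) (m : Fin M) :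
    Measurable[m₀] fun ω => D.gHat l ω m := by
  simp only [gHat_apply]
  exact (Finset.measurable_sum _ fun m' _ =>
    ((D.measurable_yE hH hN l m').sub_const _).const_mul _).add_const _

theorem measurable_gHatScalar (hH : ∀ i, Measurable[m₀] (D.H2Tilde i))
    (hN : ∀ i, Measurable[m₀] (D.Nul i)) (l : Fin KE) (m : Fin M) :
    Measurable[m₀] fun ω => D.gHatScalar l ω m := by
  simp only [gHatScalar_apply]
  exact (((D.measurable_yE hH hN l m).sub_const _).const_mul _).add_const _

theorem measurable_source (hh : ∀ i, Measurable[m₀] (D.hTilde i))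
    (hN : ∀ i, Measurable[m₀] (D.Nul i)) (j : (Fin KI ⊕ Fin (τI + τE)) × Fin M) :
    Measurable[m₀] (D.source j) := by
  obtain ⟨k | s, m⟩ := j
  exacts [hh (k, m), hN (m, s)]

theorem measurable_H1 (hh : ∀ i, Measurable[m₀] (D.hTilde i))
    (hN : ∀ i, Measurable[m₀] (D.Nul i)) (m : Fin M) (i : Fin τI) :
    Measurable[m₀] fun ω => D.H1 ω m i := by
  simp only [H1_apply]
  exact Finset.measurable_sum _ fun j _ => (D.measurable_source hh hN _).const_mul _

theorem measurable_zfDir (hH1 : ∀ m i, Measurable[m₀] fun ω => D.H1 ω m i) (t : Fin KI)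
    (m : Fin M) : Measurable[m₀] fun ω => D.zfDir t ω m :=
  measurable_zeroForcing hH1 _ _

theorem measurable_wI (hH1 : ∀ m i, Measurable[m₀] fun ω => D.H1 ω m i) (t : Fin KI)
    (m : Fin M) : Measurable[m₀] fun ω => D.wI t ω m :=
  (D.measurable_zfDir hH1 t m).const_mul _

theorem measurable_star_h_dotProduct (hh : ∀ i, Measurable[m₀] (D.hTilde i)) (k : Fin KI)
    {w : Ω → Fin M → ℂ} (hw : ∀ m, Measurable[m₀] fun ω => w ω m) :
    Measurable[m₀] fun ω => star (D.h k ω) ⬝ᵥ w ω :=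
  Finset.measurable_sum _ fun m _ =>
    ((by fun_prop : Measurable fun z : ℂ => star z).comp (D.measurable_h hh k m)).mul (hw m)

end Measurability

end SwiptModel

/-! ### Independence and laws of the channel estimates -/

theorem measurable_generated {Ω T : Type*} (f : T → Ω → ℂ) (i : T) :
    Measurable[⨆ j, MeasurableSpace.comap (f j) inferInstance] (f i) :=
  measurable_iff_comap_le.2 (le_iSup (fun j => MeasurableSpace.comap (f j) inferInstance) i)

/-- Disjoint groups of independent variables generate independent sigma-algebras; the groups are
given by index maps with disjoint ranges. -/
theorem indep_generated {Ω T α β : Type*} [MeasurableSpace Ω] {P : Measure Ω}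
    {f : T → Ω → ℂ} (hf : ∀ i, Measurable (f i)) (h : iIndepFun f P) (a : α → T) (b : β → T)
    (hab : ∀ i j, a i ≠ b j) :
    Indep (⨆ i, MeasurableSpace.comap (f (a i)) inferInstance)
      (⨆ j, MeasurableSpace.comap (f (b j)) inferInstance) P := by
  have hdis : Disjoint (Set.range a) (Set.range b) := by
    rw [Set.disjoint_left]
    rintro _ ⟨i, rfl⟩ ⟨j, hj⟩
    exact hab i j hj.symm
  have := indep_iSup_of_disjoint (fun i => (hf i).comap_le) h hdis
  rwa [iSup_range, iSup_range] at this

/-- The law of a matrix with independent entries, seen as a family of columns. -/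
theorem map_columns_eq_gaussianColumns {Ω : Type*} [MeasurableSpace Ω] {P : Measure Ω}
    {M n : ℕ} {s : Fin n → ℝ≥0} {X : Fin n × Fin M → Ω → ℂ} (hX : ∀ j, Measurable (X j))
    (hlaw : ∀ j, P.map (X j) = complexGaussian (s j.1)) (hind : iIndepFun X P) :
    P.map (fun ω i m => X (i, m) ω) = gaussianColumns M s := by
  have := hind.isProbabilityMeasure
  have h1 := hind.map_fun_eq_pi_map fun j => (hX j).aemeasurable
  simp_rw [hlaw] at h1
  have hu : Measurable fun (x : Fin n → Fin M → ℂ) (j : Fin n × Fin M) => x j.1 j.2 :=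
    measurable_pi_lambda _ fun j => (measurable_pi_apply j.2).comp (measurable_pi_apply j.1)
  have hc : Measurable fun (y : Fin n × Fin M → ℂ) (i : Fin n) (m : Fin M) => y (i, m) :=
    measurable_pi_lambda _ fun i => measurable_pi_lambda _ fun m => measurable_pi_apply (i, m)
  have h2 : Measure.pi (fun j : Fin n × Fin M => complexGaussian (s j.1)) =
      (gaussianColumns M s).map fun x j => x j.1 j.2 := by
    refine Measure.pi_eq fun t ht => ?_
    rw [Measure.map_apply hu (.univ_pi ht)]
    have : (fun (x : Fin n → Fin M → ℂ) (j : Fin n × Fin M) => x j.1 j.2) ⁻¹' Set.univ.pi t =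
        Set.univ.pi fun i => Set.univ.pi fun m => t (i, m) := by
      ext x
      simp [Set.mem_pi]
    rw [this, gaussianColumns, Measure.pi_pi, Fintype.prod_prod_type]
    simp_rw [Measure.pi_pi]
  rw [h2] at h1
  have h3 := congrArg (Measure.map fun (y : Fin n × Fin M → ℂ) (i : Fin n) (m : Fin M) => y (i, m))
    h1
  rw [Measure.map_map hc hu, Measure.map_map hc (measurable_pi_lambda _ hX)] at h3
  exact h3.trans Measure.map_id

namespace SwiptModel

variable {M N KI KE τI τE : ℕ} {Ω : Type*} [mΩ : MeasurableSpace Ω] {P : Measure Ω}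
  (D : SwiptModel M N KI KE τI τE P)

theorem measurable_sources (j : (Fin KI × Fin M) ⊕ ((Fin M × Fin N) ⊕
    ((Fin M × Fin (τI + τE)) ⊕ (Fin KI ⊕ (Fin KE ⊕ Fin KI))))) :
    Measurable (Sum.elim D.hTilde (Sum.elim D.H2Tilde (Sum.elim D.Nul
      (Sum.elim D.xI (Sum.elim D.xE D.ndl)))) j) := by
  rcases j with i | i | i | i | i | i
  exacts [D.hTilde_meas i, D.H2Tilde_meas i, D.Nul_meas i, D.xI_meas i, D.xE_meas i, D.ndl_meas i]

/-- Sigma-algebra of the small-scale fading of the IUs. -/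
abbrev sigmaIU : MeasurableSpace Ω := ⨆ i, MeasurableSpace.comap (D.hTilde i) inferInstance

/-- Sigma-algebra of the BS - RIS fading. -/
abbrev sigmaRIS : MeasurableSpace Ω := ⨆ i, MeasurableSpace.comap (D.H2Tilde i) inferInstance

/-- Sigma-algebra of the training noise. -/
abbrev sigmaNoise : MeasurableSpace Ω := ⨆ i, MeasurableSpace.comap (D.Nul i) inferInstance

/-- Downlink sources: information symbols, energy symbols and receiver noise. -/
def downlink : (Fin KI ⊕ Fin KE) ⊕ Fin KI → Ω → ℂ := Sum.elim (Sum.elim D.xI D.xE) D.ndl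

/-- Sigma-algebra of the downlink sources. -/
abbrev sigmaDownlink : MeasurableSpace Ω :=
  ⨆ i, MeasurableSpace.comap (D.downlink i) inferInstance

theorem indep_sigmaIU : Indep D.sigmaIU (D.sigmaRIS ⊔ D.sigmaNoise) P := by
  have := indep_generated D.measurable_sources D.indep Sum.inl
    (Sum.elim (fun i => .inr (.inl i)) fun i => .inr (.inr (.inl i)) :
      (Fin M × Fin N) ⊕ (Fin M × Fin (τI + τE)) → _) (by rintro i (j | j) <;> simp)
  rwa [iSup_sum] at this

theorem indep_sigmaNoise : Indep D.sigmaNoise D.sigmaRIS P :=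
  indep_generated D.measurable_sources D.indep (fun i => .inr (.inr (.inl i)))
    (fun i => .inr (.inl i)) (by simp)

theorem indep_sigmaDownlink :
    Indep D.sigmaDownlink (D.sigmaIU ⊔ (D.sigmaRIS ⊔ D.sigmaNoise)) P := by
  have := indep_generated D.measurable_sources D.indep
    (Sum.elim (Sum.elim (fun i => .inr (.inr (.inr (.inl i))))
      fun i => .inr (.inr (.inr (.inr (.inl i))))) fun i => .inr (.inr (.inr (.inr (.inr i)))) :
      (Fin KI ⊕ Fin KE) ⊕ Fin KI → _)
    (Sum.elim Sum.inl (Sum.elim (fun i => .inr (.inl i)) fun i => .inr (.inr (.inl i))) :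
      (Fin KI × Fin M) ⊕ ((Fin M × Fin N) ⊕ (Fin M × Fin (τI + τE))) → _)
    (by rintro ((i | i) | i) (j | j | j) <;> simp)
  rw [iSup_sum, iSup_sum, iSup_sum, iSup_sum] at this
  rw [sigmaDownlink, iSup_sum, iSup_sum]
  exact this

theorem source_law (j : (Fin KI ⊕ Fin (τI + τE)) × Fin M) :
    P.map (D.source j) = complexGaussian (D.sourceVar j.1) := by
  obtain ⟨k | s, m⟩ := j
  exacts [D.hTilde_law (k, m), D.Nul_law (m, s)]

theorem iIndepFun_source : iIndepFun D.source P := by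
  let e : (Fin KI ⊕ Fin (τI + τE)) × Fin M → (Fin KI × Fin M) ⊕ ((Fin M × Fin N) ⊕
      ((Fin M × Fin (τI + τE)) ⊕ (Fin KI ⊕ (Fin KE ⊕ Fin KI)))) := fun j =>
    j.1.elim (fun k => .inl (k, j.2)) fun s => .inr (.inr (.inl (j.2, s)))
  have he : Function.Injective e := by
    rintro ⟨k | s, m⟩ ⟨k' | s', m'⟩ h <;> simp_all [e]
  have := D.indep.precomp he
  convert! this using 1
  funext j
  obtain ⟨k | s, m⟩ := j <;> rfl

/-- The entries of the IU pilot projections (index `some i`) and of the error of the channel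
estimate of IU `k` (index `none`). -/
def pilotsAndErr (k : Fin KI) (j : Option (Fin τI) × Fin M) (ω : Ω) : ℂ :=
  j.1.elim (D.err k ω j.2) fun i => D.H1 ω j.2 i

/-- Variances of `pilotsAndErr`. -/
def _root_.SwiptParams.pilotsAndErrVar (D : SwiptParams M N KI KE τI τE) (k : Fin KI)
    (o : Option (Fin τI)) : ℝ≥0 := o.elim (D.errVar k) D.pilotVar

theorem measurable_pilotsAndErr (k : Fin KI) (j : Option (Fin τI) × Fin M) :
    Measurable (D.pilotsAndErr k j) := by
  have h1 := D.measurable_H1 D.hTilde_meas D.Nul_meas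
  obtain ⟨_ | i, m⟩ := j
  · exact (D.measurable_h D.hTilde_meas k m).sub ((h1 m _).const_mul _)
  · exact h1 m i

theorem iIndepFun_pilotsAndErr_and_law (k : Fin KI) :
    iIndepFun (D.pilotsAndErr k) P ∧
      ∀ j, P.map (D.pilotsAndErr k j) = complexGaussian (D.pilotsAndErrVar k j.1) := by
  have key := iIndepFun_row_linearForms (D.measurable_source D.hTilde_meas D.Nul_meas)
    D.source_law D.iIndepFun_source (fun o : Option (Fin τI) => o.elim (D.errCoef k) D.pilotCoef) ?_
  · have heq : ∀ j : Option (Fin τI) × Fin M, D.pilotsAndErr k j = fun ω =>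
        ∑ i, (j.1.elim (D.errCoef k) D.pilotCoef : Fin KI ⊕ Fin (τI + τE) → ℂ) i *
          D.source (i, j.2) ω := by
      rintro ⟨_ | i, m⟩ <;> funext ω
      exacts [D.err_apply k ω m, D.H1_apply ω m i]
    refine ⟨?_, fun j => ?_⟩
    · convert! key.1 using 1
      exact funext heq
    · rw [heq, key.2]
      obtain ⟨_ | i, m⟩ := j <;> rfl
  · rintro (_ | i) (_ | i') hne
    · exact absurd rfl hne
    · exact D.sum_sourceVar_errCoef_pilotCoef k i'
    · have := congrArg star (D.sum_sourceVar_errCoef_pilotCoef k i)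
      rw [star_zero, star_sum] at this
      rw [← this]
      refine Finset.sum_congr rfl fun j _ => ?_
      simp only [Option.elim, star_mul', Complex.star_def, Complex.conj_ofReal,
        Complex.conj_conj]
      ring
    · rw [Option.elim_some, Option.elim_some, D.sum_sourceVar_pilotCoef,
        if_neg fun h => hne (by rw [h])]

theorem iIndepFun_pilotsAndErr (k : Fin KI) : iIndepFun (D.pilotsAndErr k) P :=
  (D.iIndepFun_pilotsAndErr_and_law k).1

theorem pilotsAndErr_law (k : Fin KI) (j : Option (Fin τI) × Fin M) :
    P.map (D.pilotsAndErr k j) = complexGaussian (D.pilotsAndErrVar k j.1) :=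
  (D.iIndepFun_pilotsAndErr_and_law k).2 j

/-- Sigma-algebra of the IU pilot projections. -/
abbrev sigmaPilots : MeasurableSpace Ω :=
  ⨆ j : Fin M × Fin τI, MeasurableSpace.comap (fun ω => D.H1 ω j.1 j.2) inferInstance

/-- The error of the channel estimate of an IU is independent of the IU pilot projections, hence of
the zero-forcing directions. -/
theorem indep_err_sigmaPilots (k : Fin KI) :
    Indep (⨆ m, MeasurableSpace.comap (fun ω => D.err k ω m) inferInstance) D.sigmaPilots P :=
  indep_generated (D.measurable_pilotsAndErr k) (D.iIndepFun_pilotsAndErr k)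
    (fun m => (none, m)) (fun j : Fin M × Fin τI => (some j.2, j.1)) (by simp)

/-- Law of the matrix of IU pilot projections. It does not depend on the user `k`, who only serves
to read it from the joint law with an estimation error. -/
theorem map_H1 (k : Fin KI) :
    P.map (fun ω i m => D.H1 ω m i) = gaussianColumns M D.pilotVar :=
  map_columns_eq_gaussianColumns (X := fun (j : Fin τI × Fin M) ω => D.H1 ω j.2 j.1)
    (fun j => D.measurable_pilotsAndErr k (some j.1, j.2))
    (fun j => D.pilotsAndErr_law k (some j.1, j.2))
    ((D.iIndepFun_pilotsAndErr k).precomp (g := fun j : Fin τI × Fin M => (some j.1, j.2))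
      fun j j' h => by simpa [Prod.ext_iff] using h)

theorem measurable_columns_H1 : Measurable fun ω i m => D.H1 ω m i :=
  measurable_pi_lambda _ fun i => measurable_pi_lambda _ fun m =>
    D.measurable_H1 D.hTilde_meas D.Nul_meas m i

theorem ae_isUnit_H1 (hM : τI < M) (k : Fin KI) :
    ∀ᵐ ω ∂P, IsUnit ((D.H1 ω)ᴴ * D.H1 ω) := by
  have h := ae_linearIndependent_gaussianColumns (M := M) D.pilotVar_pos hM.le
  rw [← D.map_H1 k] at h
  filter_upwards [ae_of_ae_map D.measurable_columns_H1.aemeasurable h] with ω hω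
  exact isUnit_conjTranspose_mul_self_of_linearIndependent hω

theorem sqNorm_nonneg {m : ℕ} (v : Fin m → ℂ) : 0 ≤ sqNorm v :=
  Finset.sum_nonneg fun _ _ => by positivity

theorem measurable_H1_entries (m : Fin M) (i : Fin τI) : Measurable fun ω => D.H1 ω m i :=
  D.measurable_H1 D.hTilde_meas D.Nul_meas m i

theorem integrable_and_integral_sqNorm_zfDir (hM : τI < M)
    (t : Fin KI) :
    Integrable (fun ω => sqNorm (D.zfDir t ω)) P ∧
      ∫ ω, sqNorm (D.zfDir t ω) ∂P = 1 / (D.pilotPower (D.iI t) * (M - τI)) := by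
  have h := lintegral_sqNorm_zeroForcing (M := M) D.pilotVar_pos hM (D.iI t)
  have hF : Measurable fun x : Fin τI → Fin M → ℂ =>
      ENNReal.ofReal (sqNorm (zeroForcing (Matrix.of x)ᵀ (D.iI t))) := by
    refine ENNReal.measurable_ofReal.comp (measurable_sqNorm.comp (measurable_pi_lambda _ ?_))
    intro j
    refine measurable_zeroForcing (fun k l => ?_) _ j
    exact (measurable_pi_apply k).comp (measurable_pi_apply l)
  rw [← D.map_H1 t, lintegral_map hF D.measurable_columns_H1, D.coe_pilotVar] at h
  change ∫⁻ ω, ENNReal.ofReal (sqNorm (D.zfDir t ω)) ∂P = _ at h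
  have hm : Measurable fun ω => sqNorm (D.zfDir t ω) :=
    measurable_sqNorm.comp (measurable_pi_lambda _ (D.measurable_zfDir D.measurable_H1_entries t))
  have hnn : 0 ≤ᵐ[P] fun ω => sqNorm (D.zfDir t ω) :=
    Filter.Eventually.of_forall fun ω => sqNorm_nonneg _
  refine ⟨⟨hm.aestronglyMeasurable, ?_⟩, ?_⟩
  · rw [hasFiniteIntegral_iff_ofReal hnn, h]
    exact ENNReal.ofReal_lt_top
  · rw [integral_eq_lintegral_of_nonneg_ae hnn hm.aestronglyMeasurable, h, ENNReal.toReal_ofReal]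
    have := D.pilotPower_pos (D.iI t)
    have : (0 : ℝ) < M - τI := sub_pos.2 (by exact_mod_cast hM)
    positivity

theorem memLp_two_of_integrable_sqNorm {m : ℕ} {w : Ω → Fin m → ℂ}
    (hw : ∀ j, Measurable fun ω => w ω j) (h : Integrable (fun ω => sqNorm (w ω)) P) (j : Fin m) :
    MemLp (fun ω => w ω j) 2 P := by
  rw [memLp_two_iff_integrable_sq_norm (hw j).aestronglyMeasurable]
  refine h.mono' (by have := hw j; fun_prop) (Filter.Eventually.of_forall fun ω => ?_)
  rw [Real.norm_of_nonneg (by positivity)]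
  exact Finset.single_le_sum (f := fun j => ‖w ω j‖ ^ 2) (fun _ _ => by positivity)
    (Finset.mem_univ j)

theorem integral_sqNorm_eq_sum {m : ℕ} {w : Ω → Fin m → ℂ}
    (hw : ∀ j, MemLp (fun ω => w ω j) 2 P) :
    ∫ ω, sqNorm (w ω) ∂P = ∑ j, ∫ ω, ‖w ω j‖ ^ 2 ∂P :=
  integral_finsetSum _ fun j _ => (memLp_two_iff_integrable_sq_norm (hw j).1).1 (hw j)

theorem integrable_sqNorm {m : ℕ} {w : Ω → Fin m → ℂ}
    (hw : ∀ j, MemLp (fun ω => w ω j) 2 P) : Integrable (fun ω => sqNorm (w ω)) P :=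
  integrable_finsetSum _ fun j _ => (memLp_two_iff_integrable_sq_norm (hw j).1).1 (hw j)

theorem sqNorm_smul {m : ℕ} (c : ℝ) (v : Fin m → ℂ) :
    sqNorm ((c : ℂ) • v) = c ^ 2 * sqNorm v := by
  simp [sqNorm, mul_pow, Finset.mul_sum]

/-! ### The channel estimates of the information users -/

theorem integral_pilotsAndErr (k : Fin KI) (j : Option (Fin τI) × Fin M) :
    ∫ ω, D.pilotsAndErr k j ω ∂P = 0 :=
  integral_of_map_eq (D.measurable_pilotsAndErr k j) (D.pilotsAndErr_law k j)

theorem memLp_pilotsAndErr (k : Fin KI) (j : Option (Fin τI) × Fin M) :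
    MemLp (D.pilotsAndErr k j) 2 P :=
  memLp_two_of_map_eq (D.measurable_pilotsAndErr k j) (D.pilotsAndErr_law k j)

theorem integral_pilotsAndErr_mul_star (k : Fin KI) (i j : Option (Fin τI) × Fin M) :
    ∫ ω, D.pilotsAndErr k i ω * star (D.pilotsAndErr k j ω) ∂P =
      if i = j then ((D.pilotsAndErrVar k i.1 : ℝ) : ℂ) else 0 :=
  integral_mul_star_of_iIndepFun (D.measurable_pilotsAndErr k) (D.pilotsAndErr_law k)
    (D.iIndepFun_pilotsAndErr k) i j

theorem h_eq_cH_mul_add_err (k : Fin KI) (ω : Ω) (m : Fin M) :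
    D.h k ω m = D.cH k * D.H1 ω m (D.iI k) + D.err k ω m := by
  rw [err]; ring

theorem covMat_yI (k : Fin KI) :
    covMat P (D.yI k) (D.yI k) = (D.pilotPower (D.iI k) : ℂ) • 1 := by
  ext m m'
  have h0 : meanVec P (D.yI k) m = 0 := D.integral_pilotsAndErr k (some (D.iI k), m)
  have h1 := D.integral_pilotsAndErr_mul_star k (some (D.iI k), m) (some (D.iI k), m')
  change ∫ ω, D.yI k ω m * star (D.yI k ω m') ∂P - _ * _ = _
  rw [h0, zero_mul, sub_zero, Matrix.smul_apply, one_apply]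
  refine h1.trans ?_
  simp only [Prod.mk.injEq, true_and, SwiptParams.pilotsAndErrVar, Option.elim, D.coe_pilotVar,
    smul_eq_mul, mul_ite, mul_one, mul_zero]

/-- As `h_k = c_{h_k} y_k + e_k` with `e_k` uncorrelated with `y_k`, the matrix
`C_{hy} C_{yy}⁻¹` of the MMSE estimate is scalar. -/
theorem covMat_h_yI (k : Fin KI) :
    covMat P (D.h k) (D.yI k) = (D.cH k : ℂ) • covMat P (D.yI k) (D.yI k) := by
  ext m m'
  have h0 : meanVec P (D.yI k) m' = 0 := D.integral_pilotsAndErr k (some (D.iI k), m')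
  have h1 := D.integral_pilotsAndErr_mul_star k (none, m) (some (D.iI k), m')
  change ∫ ω, D.h k ω m * star (D.yI k ω m') ∂P - _ * _ =
    D.cH k * (∫ ω, D.yI k ω m * star (D.yI k ω m') ∂P - _ * _)
  rw [h0, star_zero, mul_zero, mul_zero, sub_zero, sub_zero]
  have h2 : ∀ ω, D.h k ω m * star (D.yI k ω m') =
      D.cH k * (D.yI k ω m * star (D.yI k ω m')) +
        D.pilotsAndErr k (none, m) ω * star (D.pilotsAndErr k (some (D.iI k), m') ω) := by
    intro ω
    rw [h_eq_cH_mul_add_err, add_mul, mul_assoc]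
    rfl
  simp_rw [h2]
  have hy : ∀ m, MemLp (fun ω => D.yI k ω m) 2 P := fun m =>
    D.memLp_pilotsAndErr k (some (D.iI k), m)
  rw [integral_add ((integrable_mul_star_of_memLp_two (hy m) (hy m')).const_mul _)
    (integrable_mul_star_of_memLp_two (D.memLp_pilotsAndErr k (none, m))
      (D.memLp_pilotsAndErr k (some (D.iI k), m'))), h1, integral_const_mul]
  simp

/-- The MMSE estimate of the channel of IU `k` is `c_{h_k} y_k`. -/
theorem hHat_apply (k : Fin KI) (ω : Ω) (m : Fin M) :
    D.hHat k ω m = D.cH k * D.H1 ω m (D.iI k) := by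
  have h0 : meanVec P (D.yI k) = 0 :=
    funext fun m => D.integral_pilotsAndErr k (some (D.iI k), m)
  have h1 : meanVec P (D.h k) = 0 := by
    funext m
    change ∫ ω, (√(D.βBI k) : ℂ) * D.hTilde (k, m) ω ∂P = 0
    rw [integral_const_mul, integral_of_map_eq (D.hTilde_meas _) (D.hTilde_law _), mul_zero]
  have hs : (D.pilotPower (D.iI k) : ℂ) ≠ 0 := by
    exact_mod_cast (D.pilotPower_pos (D.iI k)).ne'
  have h2 : covMat P (D.yI k) (D.yI k) * (covMat P (D.yI k) (D.yI k))⁻¹ = 1 := by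
    refine mul_nonsing_inv _ ?_
    rw [covMat_yI, det_smul, det_one, mul_one]
    exact (IsUnit.mk0 _ hs).pow _
  rw [hHat, mmseEstimate, covMat_h_yI, smul_mul, h2, h0, h1, sub_zero, add_zero, smul_mulVec,
    one_mulVec]
  rfl

theorem memLp_hHat (k : Fin KI) (m : Fin M) : MemLp (fun ω => D.hHat k ω m) 2 P := by
  simp_rw [hHat_apply]
  exact (D.memLp_pilotsAndErr k (some (D.iI k), m)).const_mul _

theorem integral_norm_sq_hHat (k : Fin KI) (m : Fin M) :
    ∫ ω, ‖D.hHat k ω m‖ ^ 2 ∂P = D.γH k := by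
  have h := integral_norm_sq_of_map_eq (D.measurable_pilotsAndErr k (some (D.iI k), m))
    (D.pilotsAndErr_law k (some (D.iI k), m))
  have h2 : (D.pilotsAndErrVar k (some (D.iI k)) : ℝ) = D.pilotPower (D.iI k) := D.coe_pilotVar _
  simp_rw [hHat_apply, norm_mul, mul_pow]
  rw [integral_const_mul, Complex.norm_real, Real.norm_eq_abs, sq_abs, D.γH_eq, ← h2, ← h]
  rfl

end SwiptModel

/-! ### Gains of the zero-forcing precoders -/

theorem measurable_star_complex : Measurable fun z : ℂ => star z := by fun_prop

theorem integral_norm_sq_const_add {Ω : Type*} [MeasurableSpace Ω] {P : Measure Ω}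
    [IsProbabilityMeasure P] {Z : Ω → ℂ} (hZ : MemLp Z 2 P) (h0 : ∫ ω, Z ω ∂P = 0) (c : ℂ) :
    ∫ ω, ‖c + Z ω‖ ^ 2 ∂P = ‖c‖ ^ 2 + ∫ ω, ‖Z ω‖ ^ 2 ∂P := by
  have hi : Integrable Z P := hZ.integrable (by norm_num)
  have h1 : ∀ ω, ‖c + Z ω‖ ^ 2 = ‖c‖ ^ 2 + 2 * (star c * Z ω).re + ‖Z ω‖ ^ 2 := by
    intro ω
    rw [Complex.sq_norm, Complex.sq_norm, Complex.sq_norm, Complex.normSq_add,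
      Complex.normSq_apply, Complex.normSq_apply]
    simp
    ring
  have hre : Integrable (fun ω => (star c * Z ω).re) P := (hi.const_mul _).re
  have hadd : Integrable (fun ω => ‖c‖ ^ 2 + 2 * (star c * Z ω).re) P :=
    (integrable_const _).add (hre.const_mul 2)
  simp_rw [h1]
  rw [integral_add hadd
      ((memLp_two_iff_integrable_sq_norm hZ.1).1 hZ),
    integral_add (integrable_const _) (hre.const_mul 2), integral_const_mul]
  have h2 : ∫ ω, (star c * Z ω).re ∂P = 0 := by
    have h3 := integral_re (𝕜 := ℂ) (hi.const_mul (star c))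
    rw [integral_const_mul, h0, mul_zero] at h3
    simpa using h3
  rw [h2]
  simp

namespace SwiptModel

variable {M N KI KE τI τE : ℕ} {Ω : Type*} [mΩ : MeasurableSpace Ω] {P : Measure Ω}
  (D : SwiptModel M N KI KE τI τE P)

theorem memLp_zfDir (hM : τI < M) (t : Fin KI) (m : Fin M) :
    MemLp (fun ω => D.zfDir t ω m) 2 P :=
  memLp_two_of_integrable_sqNorm (D.measurable_zfDir D.measurable_H1_entries t)
    (D.integrable_and_integral_sqNorm_zfDir hM t).1 m

theorem memLp_err (k : Fin KI) (m : Fin M) : MemLp (fun ω => D.err k ω m) 2 P :=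
  D.memLp_pilotsAndErr k (none, m)

theorem memLp_star_err (k : Fin KI) (m : Fin M) : MemLp (fun ω => star (D.err k ω m)) 2 P :=
  (D.memLp_err k m).star

theorem indepFun_star_err_zfDir (k t : Fin KI) :
    IndepFun (fun ω m => star (D.err k ω m)) (fun ω m => D.zfDir t ω m) P :=
  indepFun_of_indep (D.indep_err_sigmaPilots k)
    (measurable_of_entries fun m =>
      measurable_star_complex.comp (measurable_generated (fun m ω => D.err k ω m) m))
    (measurable_of_entries (D.measurable_zfDir
      (fun m i => measurable_generated
        (fun (j : Fin M × Fin τI) ω => D.H1 ω j.1 j.2) (m, i)) t))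

/-- Zero-forcing leaves only the estimated part of the channel, through the pilot match, and a
linear form in the estimation error. -/
theorem star_h_dotProduct_zfDir (k t : Fin KI) {ω : Ω} (hω : IsUnit ((D.H1 ω)ᴴ * D.H1 ω)) :
    star (D.h k ω) ⬝ᵥ D.zfDir t ω =
      (if D.iI t = D.iI k then (D.cH k : ℂ) else 0) +
        ∑ m, star (D.err k ω m) * D.zfDir t ω m := by
  have h1 := star_dotProduct_zeroForcing hω (D.iI t) (D.iI k)
  change star ((D.H1 ω).col (D.iI k)) ⬝ᵥ D.zfDir t ω = _ at h1
  have h2 : star (D.h k ω) = (D.cH k : ℂ) • star ((D.H1 ω).col (D.iI k)) + star (D.err k ω) := by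
    funext m
    simp only [Pi.star_apply, Pi.add_apply, Pi.smul_apply, h_eq_cH_mul_add_err, star_add,
      star_mul', Complex.star_def, Complex.conj_ofReal, smul_eq_mul, col_apply]
  rw [h2, add_dotProduct, smul_dotProduct, h1]
  congr 1
  simp [eq_comm]

theorem memLp_err_zfDir (hM : τI < M) (k t : Fin KI) :
    MemLp (fun ω => ∑ m, star (D.err k ω m) * D.zfDir t ω m) 2 P :=
  memLp_two_sum_mul (D.memLp_star_err k) (D.memLp_zfDir hM t)
    (D.indepFun_star_err_zfDir k t)

theorem integral_err_zfDir [IsProbabilityMeasure P] (hM : τI < M) (k t : Fin KI) :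
    ∫ ω, ∑ m, star (D.err k ω m) * D.zfDir t ω m ∂P = 0 := by
  refine integral_sum_mul_eq_zero (D.memLp_star_err k) (D.memLp_zfDir hM t)
    (D.indepFun_star_err_zfDir k t) fun m => ?_
  have h := D.integral_pilotsAndErr k (none, m)
  exact (integral_conj (f := fun ω => D.err k ω m)).trans (by
    rw [show ∫ ω, D.err k ω m ∂P = 0 from h, map_zero])

theorem integral_norm_sq_err_zfDir (hM : τI < M) (k t : Fin KI) :
    ∫ ω, ‖∑ m, star (D.err k ω m) * D.zfDir t ω m‖ ^ 2 ∂P =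
      (D.βBI k - D.γH k) * ∫ ω, sqNorm (D.zfDir t ω) ∂P := by
  rw [integral_norm_sq_sum_mul (D.memLp_star_err k) (D.memLp_zfDir hM t)
    (D.indepFun_star_err_zfDir k t) (v := fun _ => D.βBI k - D.γH k), ← Finset.mul_sum,
    integral_sqNorm_eq_sum (D.memLp_zfDir hM t)]
  intro i j
  have h := D.integral_pilotsAndErr_mul_star k (none, j) (none, i)
  have h2 : ∀ ω, star (D.err k ω i) * star (star (D.err k ω j)) =
      D.pilotsAndErr k (none, j) ω * star (D.pilotsAndErr k (none, i) ω) := fun ω => by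
    rw [star_star, mul_comm]; rfl
  simp_rw [h2]
  rw [h]
  simp [SwiptParams.pilotsAndErrVar, D.coe_errVar, eq_comm]

/-- Normalizing factor of the zero-forcing precoder of IU `t`. -/
def zfScale (t : Fin KI) : ℝ := 1 / √(∫ ω, sqNorm (D.zfDir t ω) ∂P)

theorem zfScale_sq (hM : τI < M) (t : Fin KI) :
    D.zfScale t ^ 2 = D.pilotPower (D.iI t) * (M - τI) := by
  have h1 := D.pilotPower_pos (D.iI t)
  have h2 : (0 : ℝ) < M - τI := sub_pos.2 (by exact_mod_cast hM)
  rw [zfScale, (D.integrable_and_integral_sqNorm_zfDir hM t).2, div_pow, one_pow,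
    Real.sq_sqrt (by positivity), one_div_one_div]

theorem wI_eq (t : Fin KI) (ω : Ω) : D.wI t ω = (D.zfScale t : ℂ) • D.zfDir t ω := rfl

theorem integrable_sqNorm_wI (hM : τI < M) (t : Fin KI) :
    Integrable (fun ω => sqNorm (D.wI t ω)) P := by
  simp_rw [wI_eq, sqNorm_smul]
  exact (D.integrable_and_integral_sqNorm_zfDir hM t).1.const_mul _

theorem integral_sqNorm_wI (hM : τI < M) (t : Fin KI) : ∫ ω, sqNorm (D.wI t ω) ∂P = 1 := by
  have h1 := D.pilotPower_pos (D.iI t)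
  have h2 : (0 : ℝ) < M - τI := sub_pos.2 (by exact_mod_cast hM)
  simp_rw [wI_eq, sqNorm_smul]
  rw [integral_const_mul, D.zfScale_sq hM, (D.integrable_and_integral_sqNorm_zfDir hM t).2]
  field_simp

theorem star_h_dotProduct_wI_ae (hM : τI < M) (k t : Fin KI) :
    (fun ω => star (D.h k ω) ⬝ᵥ D.wI t ω) =ᵐ[P] fun ω =>
      (D.zfScale t : ℂ) * ((if D.iI t = D.iI k then (D.cH k : ℂ) else 0) +
        ∑ m, star (D.err k ω m) * D.zfDir t ω m) := by
  filter_upwards [D.ae_isUnit_H1 hM k] with ω hω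
  rw [wI_eq, dotProduct_smul, D.star_h_dotProduct_zfDir k t hω, smul_eq_mul]

theorem memLp_star_h_dotProduct_wI [IsProbabilityMeasure P] (hM : τI < M) (k t : Fin KI) :
    MemLp (fun ω => star (D.h k ω) ⬝ᵥ D.wI t ω) 2 P := by
  refine MemLp.ae_eq (D.star_h_dotProduct_wI_ae hM k t).symm (MemLp.const_mul ?_ _)
  exact (memLp_const (if D.iI t = D.iI k then (D.cH k : ℂ) else 0)).add (D.memLp_err_zfDir hM k t)

theorem integral_star_h_dotProduct_wI [IsProbabilityMeasure P] (hM : τI < M) (k t : Fin KI) :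
    ∫ ω, star (D.h k ω) ⬝ᵥ D.wI t ω ∂P =
      if D.iI t = D.iI k then (D.zfScale t * D.cH k : ℂ) else 0 := by
  rw [integral_congr_ae (D.star_h_dotProduct_wI_ae hM k t), integral_const_mul,
    integral_add (integrable_const _) ((D.memLp_err_zfDir hM k t).integrable (by norm_num)),
    D.integral_err_zfDir hM]
  simp

theorem norm_sq_integral_star_h_dotProduct_wI [IsProbabilityMeasure P] (hM : τI < M) (k : Fin KI) :
    ‖∫ ω, star (D.h k ω) ⬝ᵥ D.wI k ω ∂P‖ ^ 2 = (M - τI) * D.γH k := by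
  rw [D.integral_star_h_dotProduct_wI hM, if_pos rfl, ← Complex.ofReal_mul, Complex.norm_real,
    Real.norm_eq_abs, sq_abs, mul_pow, D.zfScale_sq hM, D.γH_eq]
  ring

/-- Mean square gain of the precoder of IU `t` at IU `k`: the pilot match, present only if the two
users share their pilot, and the leakage through the estimation error. -/
theorem integral_norm_sq_star_h_dotProduct_wI [IsProbabilityMeasure P] (hM : τI < M)
    (k t : Fin KI) :
    ∫ ω, ‖star (D.h k ω) ⬝ᵥ D.wI t ω‖ ^ 2 ∂P =
      (if D.iI t = D.iI k then (M - τI) * D.γH k else 0) + (D.βBI k - D.γH k) := by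
  have hae : (fun ω => ‖star (D.h k ω) ⬝ᵥ D.wI t ω‖ ^ 2) =ᵐ[P] fun ω =>
      D.zfScale t ^ 2 * ‖(if D.iI t = D.iI k then (D.cH k : ℂ) else 0) +
        ∑ m, star (D.err k ω m) * D.zfDir t ω m‖ ^ 2 := by
    filter_upwards [D.star_h_dotProduct_wI_ae hM k t] with ω hω
    rw [hω, norm_mul, mul_pow, Complex.norm_real, Real.norm_eq_abs, sq_abs]
  have h1 := D.pilotPower_pos (D.iI t)
  have h2 : (0 : ℝ) < M - τI := sub_pos.2 (by exact_mod_cast hM)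
  rw [integral_congr_ae hae, integral_const_mul,
    integral_norm_sq_const_add (D.memLp_err_zfDir hM k t) (D.integral_err_zfDir hM k t),
    D.integral_norm_sq_err_zfDir hM, (D.integrable_and_integral_sqNorm_zfDir hM t).2,
    D.zfScale_sq hM]
  split_ifs with h
  · rw [Complex.norm_real, Real.norm_eq_abs, sq_abs, D.γH_eq, h]
    rw [h] at h1
    field_simp
  · rw [norm_zero]
    field_simp
    ring

/-! ### Energy precoders -/

theorem memLp_h (k : Fin KI) (m : Fin M) : MemLp (fun ω => D.h k ω m) 2 P :=
  (memLp_two_of_map_eq (D.hTilde_meas (k, m)) (D.hTilde_law (k, m))).const_mul _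

theorem integral_h_mul_star (k : Fin KI) (m m' : Fin M) :
    ∫ ω, D.h k ω m * star (D.h k ω m') ∂P = if m = m' then (D.βBI k : ℂ) else 0 := by
  have hind : iIndepFun D.hTilde P := D.indep.precomp (g := Sum.inl) Sum.inl_injective
  have h := integral_mul_star_of_iIndepFun D.hTilde_meas D.hTilde_law hind (k, m) (k, m')
  have h2 : ∀ ω, D.h k ω m * star (D.h k ω m') =
      (D.βBI k : ℂ) * (D.hTilde (k, m) ω * star (D.hTilde (k, m') ω)) := by
    intro ω
    have h3 : ((√(D.βBI k) * √(D.βBI k) : ℝ) : ℂ) = D.βBI k := by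
      rw [Real.mul_self_sqrt (D.βBI_pos k).le]
    simp only [SwiptModel.h, star_mul', Complex.star_def, Complex.conj_ofReal]
    rw [← h3]
    push_cast
    ring
  simp_rw [h2]
  rw [integral_const_mul, h]
  simp

/-- A precoder that depends only on the BS - RIS fading and on the training noise is independent of
the channel of IU `k`, so its gain has mean square `β_{BI,k}` times its power. -/
theorem memLp_and_integral_norm_sq_star_h_dotProduct (k : Fin KI) {w : Ω → Fin M → ℂ}
    (hw : ∀ m, Measurable[D.sigmaRIS ⊔ D.sigmaNoise] fun ω => w ω m)
    (hw2 : ∀ m, MemLp (fun ω => w ω m) 2 P) :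
    MemLp (fun ω => star (D.h k ω) ⬝ᵥ w ω) 2 P ∧
      ∫ ω, ‖star (D.h k ω) ⬝ᵥ w ω‖ ^ 2 ∂P = D.βBI k * ∫ ω, sqNorm (w ω) ∂P := by
  have hind : IndepFun (fun ω m => star (D.h k ω m)) (fun ω m => w ω m) P :=
    indepFun_of_indep D.indep_sigmaIU
      (measurable_of_entries fun m => measurable_star_complex.comp
        (D.measurable_h (measurable_generated D.hTilde) k m)) (measurable_of_entries hw)
  refine ⟨memLp_two_sum_mul (fun m => (D.memLp_h k m).star) hw2 hind, ?_⟩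
  have h := integral_norm_sq_sum_mul (fun m => (D.memLp_h k m).star) hw2 hind
    (v := fun _ => D.βBI k) fun i j => ?_
  · rw [integral_sqNorm_eq_sum hw2, Finset.mul_sum]
    exact h
  · have h2 : ∀ ω, star (D.h k ω i) * star (star (D.h k ω j)) = D.h k ω j * star (D.h k ω i) :=
      fun ω => by rw [star_star, mul_comm]
    change ∫ ω, star (D.h k ω i) * star (star (D.h k ω j)) ∂P = _
    simp_rw [h2]
    rw [integral_h_mul_star]
    simp [eq_comm]

theorem memLp_g [IsProbabilityMeasure P] (l : Fin KE) (m : Fin M) :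
    MemLp (fun ω => D.g l ω m) 2 P := by
  have h1 : MemLp (fun ω => ∑ n, (D.Θ *ᵥ D.f l) n * D.H2Tilde (m, n) ω) 2 P :=
    memLp_finsetSum _ fun n _ =>
      (memLp_two_of_map_eq (D.H2Tilde_meas (m, n)) (D.H2Tilde_law (m, n))).const_mul _
  simp_rw [g_apply]
  exact (memLp_const (D.gbar l m)).add (h1.const_mul _)

theorem memLp_yE [IsProbabilityMeasure P] (l : Fin KE) (m : Fin M) :
    MemLp (fun ω => D.yE l ω m) 2 P := by
  simp_rw [yE_apply]
  exact ((memLp_finsetSum _ fun l' _ => (D.memLp_g l' m).const_mul _).const_mul _).add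
    (memLp_finsetSum _ fun s _ =>
      (memLp_two_of_map_eq (D.Nul_meas (m, s)) (D.Nul_law (m, s))).const_mul _)

theorem memLp_gHat [IsProbabilityMeasure P] (l : Fin KE) (m : Fin M) :
    MemLp (fun ω => D.gHat l ω m) 2 P := by
  have h1 : ∀ m', MemLp (fun ω => D.yE l ω m' - meanVec P (D.yE l) m') 2 P := fun m' =>
    (D.memLp_yE l m').sub (memLp_const _)
  simp_rw [gHat_apply]
  exact (memLp_finsetSum _ fun m' _ => (h1 m').const_mul _).add (memLp_const (meanVec P (D.g l) m))

theorem memLp_gHatScalar [IsProbabilityMeasure P] (l : Fin KE) (m : Fin M) :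
    MemLp (fun ω => D.gHatScalar l ω m) 2 P := by
  simp_rw [gHatScalar_apply]
  exact (((D.memLp_yE l m).sub (memLp_const _)).const_mul _).add (memLp_const (D.gbar l m))

theorem cG_pos (hN : 0 < N) (l : Fin KE) : 0 < D.cG l := by
  have hτ : 0 < τI + τE := by have := (D.iE l).2; omega
  have h1 : 0 < D.τp := mul_pos (by exact_mod_cast hτ) D.p_pos
  have hN' : (0 : ℝ) < N := by exact_mod_cast hN
  have hlam : ∀ l, 0 < D.lam l := fun l =>
    div_pos (mul_pos (D.βRE_pos l) D.β_pos) (by linarith [D.δ_nonneg])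
  have h2 : (0 : ℝ) < D.σ2 := D.σ2_pos
  refine div_pos (mul_pos (Real.sqrt_pos.2 h1) (mul_pos hN' (hlam l))) ?_
  refine add_pos_of_nonneg_of_pos (mul_nonneg h1.le (add_nonneg
    (Finset.sum_nonneg fun l' _ => ?_) (Finset.sum_nonneg fun k _ => ?_))) h2
  · exact mul_nonneg (mul_nonneg hN'.le (hlam l').le) (by positivity)
  · exact mul_nonneg (D.βBI_pos k).le (by positivity)

/-- The scalar estimate of an energy channel is not almost surely zero: otherwise the projected
training noise would be almost surely a function of the BS - RIS fading, of which it is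
independent. -/
theorem integral_sqNorm_gHatScalar_ne_zero [IsProbabilityMeasure P] (hN : 0 < N) (hM : 0 < M)
    (l : Fin KE) :
    ∫ ω, sqNorm (D.gHatScalar l ω) ∂P ≠ 0 := by
  intro h0
  rw [integral_eq_zero_iff_of_nonneg (fun ω => sqNorm_nonneg _)
    (integrable_sqNorm (D.memLp_gHatScalar l))] at h0
  let m : Fin M := ⟨0, hM⟩
  let Z : Ω → ℂ := fun ω => ∑ s, D.φE (D.iE l) s * D.Nul (m, s) ω
  have hZind : iIndepFun (fun s => D.Nul (m, s)) P :=
    D.indep.precomp (g := fun s => .inr (.inr (.inl (m, s)))) fun s s' h => by simpa using h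
  have hZlaw := map_linearForm_eq_complexGaussian (fun s => D.Nul_meas (m, s))
    (fun s => D.Nul_law (m, s)) hZind (D.φE (D.iE l))
  have hZm : Measurable Z :=
    Finset.measurable_sum _ fun s _ => (D.Nul_meas (m, s)).const_mul _
  -- the projected noise has variance `σ2`, the pilots being of unit norm
  have hZ2 : ∫ ω, ‖Z ω‖ ^ 2 ∂P = D.σ2 := by
    rw [integral_norm_sq_of_map_eq hZm hZlaw, ← Finset.mul_sum]
    have h1 := D.φE_orth (D.iE l) (D.iE l)
    rw [if_pos rfl, ← sqNorm_eq_dotProduct] at h1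
    have h2 : sqNorm (D.φE (D.iE l)) = 1 := by exact_mod_cast h1
    push_cast
    rw [show ∑ s, ‖D.φE (D.iE l) s‖ ^ 2 = 1 from h2, mul_one]
  let F : Ω → ℂ := fun ω => (√D.τp : ℂ) *
    ∑ l', (star (D.φE (D.iE l')) ⬝ᵥ D.φE (D.iE l)) * D.g l' ω m
  obtain ⟨c, hc⟩ : ∃ c : ℂ, ∀ᵐ ω ∂P, Z ω = c - F ω := by
    have hcG : (D.cG l : ℂ) ≠ 0 := by exact_mod_cast (D.cG_pos hN l).ne'
    refine ⟨((√D.τp : ℂ) • ∑ l', (star (D.φE (D.iE l')) ⬝ᵥ D.φE (D.iE l)) • D.gbar l') m -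
      D.gbar l m / D.cG l, ?_⟩
    filter_upwards [h0] with ω hω
    have h1 : ‖D.gHatScalar l ω m‖ ^ 2 = 0 :=
      (Finset.sum_eq_zero_iff_of_nonneg fun _ _ => by positivity).1 hω m (Finset.mem_univ m)
    have h2 : D.gHatScalar l ω m = 0 := by simpa using h1
    rw [gHatScalar_apply, yE_apply] at h2
    change D.cG l * (F ω + Z ω - _) + _ = 0 at h2
    field_simp
    linear_combination h2
  have hind : IndepFun Z (fun ω => star (c - F ω)) P :=
    indepFun_of_indep D.indep_sigmaNoise
      (Finset.measurable_sum _ fun s _ => (measurable_generated D.Nul (m, s)).const_mul _)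
      (measurable_star_complex.comp
        ((D.measurable_sum_mul_g (measurable_generated D.H2Tilde) _ m).const_sub c))
  have h3 : ∫ ω, Z ω * star (c - F ω) ∂P = 0 := by
    rw [hind.integral_fun_mul_eq_mul_integral hZm.aestronglyMeasurable
      (measurable_star_complex.comp
        ((D.measurable_sum_mul_g D.H2Tilde_meas _ m).const_sub c)).aestronglyMeasurable,
      integral_of_map_eq hZm hZlaw, zero_mul]
  have h4 : ∫ ω, Z ω * star (c - F ω) ∂P = ((∫ ω, ‖Z ω‖ ^ 2 ∂P : ℝ) : ℂ) := by
    rw [← integral_complex_ofReal]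
    refine integral_congr_ae ?_
    filter_upwards [hc] with ω hω
    rw [← hω]
    simp [Complex.mul_conj, Complex.normSq_eq_norm_sq]
  rw [h4, hZ2] at h3
  exact D.σ2_pos.ne' (by exact_mod_cast h3)

/-- What the energy precoders are built from: a square-integrable vector, not almost surely zero,
that depends only on the BS - RIS fading and on the training noise. -/
structure IsEnergyEstimate (w : Ω → Fin M → ℂ) : Prop where
  measurable : ∀ m, Measurable[D.sigmaRIS ⊔ D.sigmaNoise] fun ω => w ω m
  memLp : ∀ m, MemLp (fun ω => w ω m) 2 P
  ne_zero : ∫ ω, sqNorm (w ω) ∂P ≠ 0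

theorem measurable_H2Tilde_sigma (i : Fin M × Fin N) :
    Measurable[D.sigmaRIS ⊔ D.sigmaNoise] (D.H2Tilde i) :=
  (measurable_generated D.H2Tilde i).mono le_sup_left le_rfl

theorem measurable_Nul_sigma (i : Fin M × Fin (τI + τE)) :
    Measurable[D.sigmaRIS ⊔ D.sigmaNoise] (D.Nul i) :=
  (measurable_generated D.Nul i).mono le_sup_right le_rfl

theorem isEnergyEstimate_gHat [IsProbabilityMeasure P] (l : Fin KE)
    (h : ∫ ω, sqNorm (D.gHat l ω) ∂P ≠ 0) :
    D.IsEnergyEstimate (D.gHat l) :=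
  ⟨D.measurable_gHat D.measurable_H2Tilde_sigma D.measurable_Nul_sigma l, D.memLp_gHat l, h⟩

theorem isEnergyEstimate_gHatScalar [IsProbabilityMeasure P] (hN : 0 < N) (hM : 0 < M)
    (l : Fin KE) :
    D.IsEnergyEstimate (D.gHatScalar l) :=
  ⟨D.measurable_gHatScalar D.measurable_H2Tilde_sigma D.measurable_Nul_sigma l,
    D.memLp_gHatScalar l, D.integral_sqNorm_gHatScalar_ne_zero hN hM l⟩

namespace IsEnergyEstimate

variable {D} {w : Ω → Fin M → ℂ}

theorem memLp_mrtPrecoder (hw : D.IsEnergyEstimate w) (m : Fin M) :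
    MemLp (fun ω => mrtPrecoder P w ω m) 2 P :=
  (hw.memLp m).const_mul _

theorem measurable_mrtPrecoder (hw : D.IsEnergyEstimate w) (m : Fin M) :
    Measurable[D.sigmaRIS ⊔ D.sigmaNoise] fun ω => mrtPrecoder P w ω m :=
  (hw.measurable m).const_mul _

theorem integral_sqNorm_mrtPrecoder (hw : D.IsEnergyEstimate w) :
    ∫ ω, sqNorm (mrtPrecoder P w ω) ∂P = 1 := by
  simp_rw [mrtPrecoder, sqNorm_smul]
  rw [integral_const_mul, div_pow, one_pow,
    Real.sq_sqrt (integral_nonneg fun ω => sqNorm_nonneg _), one_div_mul_cancel hw.ne_zero]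

theorem memLp_gain (hw : D.IsEnergyEstimate w) (k : Fin KI) :
    MemLp (fun ω => star (D.h k ω) ⬝ᵥ mrtPrecoder P w ω) 2 P :=
  (D.memLp_and_integral_norm_sq_star_h_dotProduct k hw.measurable_mrtPrecoder
    hw.memLp_mrtPrecoder).1

theorem integral_norm_sq_gain (hw : D.IsEnergyEstimate w) (k : Fin KI) :
    ∫ ω, ‖star (D.h k ω) ⬝ᵥ mrtPrecoder P w ω‖ ^ 2 ∂P = D.βBI k := by
  rw [(D.memLp_and_integral_norm_sq_star_h_dotProduct k hw.measurable_mrtPrecoder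
    hw.memLp_mrtPrecoder).2, hw.integral_sqNorm_mrtPrecoder, mul_one]

end IsEnergyEstimate

/-! ### The effective noise and the effective SINR -/

/-- Variances of the downlink sources. -/
def _root_.SwiptParams.downlinkVar (D : SwiptParams M N KI KE τI τE) :
    (Fin KI ⊕ Fin KE) ⊕ Fin KI → ℝ≥0 := Sum.elim (fun _ => 1) fun _ => D.σ2

theorem measurable_downlink (j : (Fin KI ⊕ Fin KE) ⊕ Fin KI) : Measurable (D.downlink j) := by
  rcases j with (t | l) | t
  exacts [D.xI_meas t, D.xE_meas l, D.ndl_meas t]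

theorem downlink_law (j : (Fin KI ⊕ Fin KE) ⊕ Fin KI) :
    P.map (D.downlink j) = complexGaussian (D.downlinkVar j) := by
  rcases j with (t | l) | t
  exacts [D.xI_law t, D.xE_law l, D.ndl_law t]

theorem iIndepFun_downlink : iIndepFun D.downlink P := by
  let e : (Fin KI ⊕ Fin KE) ⊕ Fin KI → (Fin KI × Fin M) ⊕ ((Fin M × Fin N) ⊕
      ((Fin M × Fin (τI + τE)) ⊕ (Fin KI ⊕ (Fin KE ⊕ Fin KI)))) :=
    Sum.elim (Sum.elim (fun i => .inr (.inr (.inr (.inl i))))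
      fun i => .inr (.inr (.inr (.inr (.inl i))))) fun i => .inr (.inr (.inr (.inr (.inr i))))
  have he : Function.Injective e := by
    rintro ((i | i) | i) ((j | j) | j) h <;> simp_all [e]
  have := D.indep.precomp he
  convert! this using 1
  funext j
  rcases j with (t | l) | t <;> rfl

/-- Coefficient of each downlink source in the effective noise of IU `k`. The own symbol of IU `k`
has its gain reduced by the mean `DS_k`, and only the receiver noise of IU `k` is seen. -/
def noiseCoef (ghat : Fin KE → Ω → Fin M → ℂ) (k : Fin KI) :
    (Fin KI ⊕ Fin KE) ⊕ Fin KI → Ω → ℂ :=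
  Sum.elim (Sum.elim
    (fun t ω => (√(D.pI t) : ℂ) * (star (D.h k ω) ⬝ᵥ D.wI t ω) + if t = k then -D.DS k else 0)
    fun l ω => (√(D.pE l) : ℂ) * (star (D.h k ω) ⬝ᵥ mrtPrecoder P (ghat l) ω))
    fun t _ => if t = k then 1 else 0

theorem effNoise_eq_sum (ghat : Fin KE → Ω → Fin M → ℂ) (k : Fin KI) (ω : Ω) :
    D.effNoise ghat k ω = ∑ j, D.downlink j ω * D.noiseCoef ghat k j ω := by
  simp only [Fintype.sum_sum_type, noiseCoef, downlink, Sum.elim_inl, Sum.elim_inr, mul_add,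
    Finset.sum_add_distrib, mul_ite, mul_zero, mul_one, Finset.sum_ite_eq', Finset.mem_univ,
    if_true, effNoise, rxSignal, txSignal, dotProduct_add, dotProduct_sum, dotProduct_smul,
    smul_eq_mul]
  have h1 : ∀ a b c : ℂ, a * b * c = b * (a * c) := fun a b c => by ring
  simp only [h1]
  ring

variable {ghat : Fin KE → Ω → Fin M → ℂ}

theorem measurable_noiseCoef (hE : ∀ l, D.IsEnergyEstimate (ghat l)) (k : Fin KI)
    (j : (Fin KI ⊕ Fin KE) ⊕ Fin KI) :
    Measurable[D.sigmaIU ⊔ (D.sigmaRIS ⊔ D.sigmaNoise)] (D.noiseCoef ghat k j) := by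
  have hh : ∀ i, Measurable[D.sigmaIU ⊔ (D.sigmaRIS ⊔ D.sigmaNoise)] (D.hTilde i) := fun i =>
    (measurable_generated D.hTilde i).mono le_sup_left le_rfl
  have hn : ∀ i, Measurable[D.sigmaIU ⊔ (D.sigmaRIS ⊔ D.sigmaNoise)] (D.Nul i) := fun i =>
    (D.measurable_Nul_sigma i).mono le_sup_right le_rfl
  rcases j with (t | l) | t
  · exact ((D.measurable_star_h_dotProduct hh k
      (D.measurable_wI (D.measurable_H1 hh hn) t)).const_mul _).add_const _
  · exact (D.measurable_star_h_dotProduct hh k fun m =>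
      ((hE l).measurable_mrtPrecoder m).mono le_sup_right le_rfl).const_mul _
  · exact measurable_const

theorem memLp_noiseCoef [IsProbabilityMeasure P] (hM : τI < M)
    (hE : ∀ l, D.IsEnergyEstimate (ghat l)) (k : Fin KI) (j : (Fin KI ⊕ Fin KE) ⊕ Fin KI) :
    MemLp (D.noiseCoef ghat k j) 2 P := by
  rcases j with (t | l) | t
  · exact ((D.memLp_star_h_dotProduct_wI hM k t).const_mul _).add
      (memLp_const (if t = k then -D.DS k else 0))
  · exact ((hE l).memLp_gain k).const_mul _
  · exact memLp_const (if t = k then (1 : ℂ) else 0)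

theorem indepFun_downlink_noiseCoef (hE : ∀ l, D.IsEnergyEstimate (ghat l)) (k : Fin KI) :
    IndepFun (fun ω j => D.downlink j ω) (fun ω j => D.noiseCoef ghat k j ω) P :=
  indepFun_of_indep D.indep_sigmaDownlink (measurable_of_entries (measurable_generated D.downlink))
    (measurable_of_entries (D.measurable_noiseCoef hE k))

theorem memLp_downlink (j : (Fin KI ⊕ Fin KE) ⊕ Fin KI) : MemLp (D.downlink j) 2 P :=
  memLp_two_of_map_eq (D.measurable_downlink j) (D.downlink_law j)

theorem memLp_effNoise [IsProbabilityMeasure P] (hM : τI < M)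
    (hE : ∀ l, D.IsEnergyEstimate (ghat l)) (k : Fin KI) : MemLp (D.effNoise ghat k) 2 P := by
  have h := memLp_two_sum_mul D.memLp_downlink (D.memLp_noiseCoef hM hE k)
    (D.indepFun_downlink_noiseCoef hE k)
  rwa [← funext (D.effNoise_eq_sum ghat k)] at h

/-- Variance of the scaled gain `√p G`. -/
theorem integral_norm_sq_gain_deviation [IsProbabilityMeasure P] {G : Ω → ℂ} (hG : MemLp G 2 P)
    {p : ℝ} (hp : 0 ≤ p) :
    ∫ ω, ‖(√p : ℂ) * G ω + -((√p : ℂ) * ∫ ω', G ω' ∂P)‖ ^ 2 ∂P =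
      p * (∫ ω, ‖G ω‖ ^ 2 ∂P) - p * ‖∫ ω, G ω ∂P‖ ^ 2 := by
  set μ := ∫ ω, G ω ∂P with hμ
  have hZ : MemLp (fun ω => G ω - μ) 2 P := hG.sub (memLp_const μ)
  have hZ0 : ∫ ω, (G ω - μ) ∂P = 0 := by
    rw [integral_sub (hG.integrable (by norm_num)) (integrable_const _), ← hμ]
    simp
  have h1 := integral_norm_sq_const_add hZ hZ0 μ
  simp only [add_sub_cancel] at h1
  have h2 : ∀ ω, ‖(√p : ℂ) * G ω + -((√p : ℂ) * μ)‖ ^ 2 = p * ‖G ω - μ‖ ^ 2 := by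
    intro ω
    rw [← sub_eq_add_neg, ← mul_sub, norm_mul, mul_pow, Complex.norm_real, Real.norm_eq_abs,
      sq_abs, Real.sq_sqrt hp]
  simp_rw [h2]
  rw [integral_const_mul, h1]
  ring

theorem norm_sqrt_mul_sq {p : ℝ} (hp : 0 ≤ p) (z : ℂ) : ‖(√p : ℂ) * z‖ ^ 2 = p * ‖z‖ ^ 2 := by
  rw [norm_mul, mul_pow, Complex.norm_real, Real.norm_eq_abs, sq_abs, Real.sq_sqrt hp]

/-- Power of the effective noise: the sources being uncorrelated and independent of the gains, the
powers of the beamforming gain uncertainty, of the interference and of the noise add up. -/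
theorem integral_norm_sq_effNoise [IsProbabilityMeasure P] (hM : τI < M)
    (hE : ∀ l, D.IsEnergyEstimate (ghat l)) (k : Fin KI) :
    ∫ ω, ‖D.effNoise ghat k ω‖ ^ 2 ∂P =
      (∑ t, D.pI t * ∫ ω, ‖star (D.h k ω) ⬝ᵥ D.wI t ω‖ ^ 2 ∂P) +
        (∑ l, D.pE l * ∫ ω, ‖star (D.h k ω) ⬝ᵥ mrtPrecoder P (ghat l) ω‖ ^ 2 ∂P) -
        D.pI k * ‖∫ ω, star (D.h k ω) ⬝ᵥ D.wI k ω ∂P‖ ^ 2 + D.σ2 := by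
  simp_rw [effNoise_eq_sum]
  rw [integral_norm_sq_sum_mul D.memLp_downlink (D.memLp_noiseCoef hM hE k)
    (D.indepFun_downlink_noiseCoef hE k) (v := fun j => D.downlinkVar j)
    (integral_mul_star_of_iIndepFun D.measurable_downlink D.downlink_law D.iIndepFun_downlink),
    Fintype.sum_sum_type, Fintype.sum_sum_type]
  simp only [SwiptParams.downlinkVar, Sum.elim_inl, Sum.elim_inr, noiseCoef, NNReal.coe_one,
    one_mul]
  have h1 : ∀ t, ∫ ω, ‖(√(D.pI t) : ℂ) * (star (D.h k ω) ⬝ᵥ D.wI t ω) +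
      if t = k then -D.DS k else 0‖ ^ 2 ∂P =
        D.pI t * (∫ ω, ‖star (D.h k ω) ⬝ᵥ D.wI t ω‖ ^ 2 ∂P) -
          if t = k then D.pI k * ‖∫ ω, star (D.h k ω) ⬝ᵥ D.wI k ω ∂P‖ ^ 2 else 0 := by
    intro t
    by_cases ht : t = k
    · subst ht
      simp only [if_true]
      exact integral_norm_sq_gain_deviation (D.memLp_star_h_dotProduct_wI hM t t) (D.pI_nonneg t)
    · simp only [if_neg ht, add_zero, sub_zero, norm_sqrt_mul_sq (D.pI_nonneg t)]
      rw [integral_const_mul]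
  have h2 : ∑ t : Fin KI, (D.σ2 : ℝ) * ∫ _ : Ω, ‖if t = k then (1 : ℂ) else 0‖ ^ 2 ∂P =
      D.σ2 := by
    rw [Finset.sum_eq_single k (fun t _ ht => by simp [ht]) (by simp)]
    simp
  rw [h2]
  simp_rw [h1, norm_sqrt_mul_sq (D.pE_nonneg _), integral_const_mul]
  rw [Finset.sum_sub_distrib, Finset.sum_ite_eq' Finset.univ k, if_pos (Finset.mem_univ k)]
  ring

theorem integral_norm_sq_DS_mul_xI (k : Fin KI) :
    ∫ ω, ‖D.DS k * D.xI k ω‖ ^ 2 ∂P =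
      D.pI k * ‖∫ ω, star (D.h k ω) ⬝ᵥ D.wI k ω ∂P‖ ^ 2 := by
  simp_rw [norm_mul, mul_pow]
  rw [integral_const_mul, integral_norm_sq_of_map_eq (D.xI_meas k) (D.xI_law k), DS,
    norm_sqrt_mul_sq (D.pI_nonneg k), NNReal.coe_one, mul_one]

theorem sinr_eq_moments [IsProbabilityMeasure P] (hM : τI < M)
    (hE : ∀ l, D.IsEnergyEstimate (ghat l)) (k : Fin KI) :
    D.sinr ghat k =
      D.ρI k * ‖∫ ω, star (D.h k ω) ⬝ᵥ D.wI k ω ∂P‖ ^ 2 /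
        ((∑ t, D.ρI t * ∫ ω, ‖star (D.h k ω) ⬝ᵥ D.wI t ω‖ ^ 2 ∂P)
          + (∑ l, D.ρE l * ∫ ω, ‖star (D.h k ω) ⬝ᵥ mrtPrecoder P (ghat l) ω‖ ^ 2 ∂P)
          - D.ρI k * ‖∫ ω, star (D.h k ω) ⬝ᵥ D.wI k ω ∂P‖ ^ 2 + 1) := by
  have hσ : (D.σ2 : ℝ) ≠ 0 := by exact_mod_cast D.σ2_pos.ne'
  -- divide numerator and denominator by the noise power
  rw [sinr, integral_norm_sq_DS_mul_xI, D.integral_norm_sq_effNoise hM hE,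
    ← div_div_div_cancel_right₀ hσ]
  simp only [SwiptParams.ρI, SwiptParams.ρE, div_mul_eq_mul_div, ← Finset.sum_div]
  congr 1
  rw [add_div, sub_div, add_div, div_self hσ]

theorem sinr_eq_sinrPZF [IsProbabilityMeasure P] (hM : τI < M)
    (hE : ∀ l, D.IsEnergyEstimate (ghat l)) (k : Fin KI) : D.sinr ghat k = D.sinrPZF k := by
  -- the pilot matches split into pilot contamination and the desired signal, which cancels
  have hsum : ∑ t, (D.ρI t * if D.iI t = D.iI k then ((M : ℝ) - τI) * D.γH k else 0) =
      (∑ t ∈ (D.sharers k).erase k, ((M : ℝ) - τI) * D.ρI t * D.γH k) +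
        D.ρI k * ((M - τI) * D.γH k) := by
    have hk : k ∈ D.sharers k := by simp [SwiptParams.sharers]
    simp_rw [mul_ite, mul_zero]
    rw [← Finset.sum_filter]
    change ∑ t ∈ D.sharers k, _ = _
    rw [← Finset.sum_erase_add _ _ hk]
    congr 1
    exact Finset.sum_congr rfl fun t _ => by ring
  rw [D.sinr_eq_moments hM hE, SwiptParams.sinrPZF, D.norm_sq_integral_star_h_dotProduct_wI hM]
  simp_rw [D.integral_norm_sq_star_h_dotProduct_wI hM, (hE _).integral_norm_sq_gain k, mul_add]
  rw [Finset.sum_add_distrib, hsum]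
  congr 1
  · ring
  · simp_rw [mul_sub]
    ring

end SwiptModel

end

theorem proposition1 {M N KI KE τI τE : ℕ} {Ω : Type*} [MeasurableSpace Ω] (P : Measure Ω)
    [IsProbabilityMeasure P] (hN : 0 < N) (hM : τI < M)
    (D : SwiptModel M N KI KE τI τE P)
    (ghat : Fin KE → Ω → Fin M → ℂ)
    (hghat : (∀ l, ghat l = D.gHat l ∧ ∫ ω, sqNorm (D.gHat l ω) ∂P ≠ 0) ∨
      ∀ l, ghat l = D.gHatScalar l)
    (k : Fin KI) :
    -- the mean square of each entry of the MMSE estimate of the channel of the user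
    (∀ m, Integrable (fun ω => ‖D.hHat k ω m‖ ^ 2) P ∧
      ∫ ω, ‖D.hHat k ω m‖ ^ 2 ∂P = D.γH k) ∧
    -- the precoders are well defined and normalized
    (∀ᵐ ω ∂P, IsUnit ((D.H1 ω)ᴴ * D.H1 ω)) ∧
    (∀ t, Integrable (fun ω => sqNorm (D.wI t ω)) P ∧ ∫ ω, sqNorm (D.wI t ω) ∂P = 1) ∧
    (∀ l, Integrable (fun ω => sqNorm (mrtPrecoder P (ghat l) ω)) P ∧
      ∫ ω, sqNorm (mrtPrecoder P (ghat l) ω) ∂P = 1) ∧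
    -- all moments in the hardening bound exist
    (∀ t, MemLp (fun ω => star (D.h k ω) ⬝ᵥ D.wI t ω) 2 P) ∧
    (∀ l, MemLp (fun ω => star (D.h k ω) ⬝ᵥ mrtPrecoder P (ghat l) ω) 2 P) ∧
    MemLp (D.effNoise ghat k) 2 P ∧
    -- the effective SINR, in moments and in closed form
    D.sinr ghat k =
      D.ρI k * ‖∫ ω, star (D.h k ω) ⬝ᵥ D.wI k ω ∂P‖ ^ 2 /
        ((∑ t, D.ρI t * ∫ ω, ‖star (D.h k ω) ⬝ᵥ D.wI t ω‖ ^ 2 ∂P)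
          + (∑ l, D.ρE l * ∫ ω, ‖star (D.h k ω) ⬝ᵥ mrtPrecoder P (ghat l) ω‖ ^ 2 ∂P)
          - D.ρI k * ‖∫ ω, star (D.h k ω) ⬝ᵥ D.wI k ω ∂P‖ ^ 2 + 1) ∧
    D.sinr ghat k = D.sinrPZF k ∧
    D.SE ghat k =
      (1 - ((τI + τE : ℕ) : ℝ) / D.τc) * Real.logb 2 (1 + D.sinrPZF k) := by
  have hE : ∀ l, D.IsEnergyEstimate (ghat l) := fun l => by
    rcases hghat with h | h
    · rw [(h l).1]
      exact D.isEnergyEstimate_gHat l (h l).2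
    · rw [h l]
      exact D.isEnergyEstimate_gHatScalar hN (by omega) l
  refine ⟨fun m => ⟨?_, D.integral_norm_sq_hHat k m⟩, D.ae_isUnit_H1 hM k,
    fun t => ⟨D.integrable_sqNorm_wI hM t, D.integral_sqNorm_wI hM t⟩,
    fun l => ⟨SwiptModel.integrable_sqNorm (hE l).memLp_mrtPrecoder,
      (hE l).integral_sqNorm_mrtPrecoder⟩,
    D.memLp_star_h_dotProduct_wI hM k, fun l => (hE l).memLp_gain k, D.memLp_effNoise hM hE k,
    D.sinr_eq_moments hM hE k, D.sinr_eq_sinrPZF hM hE k, ?_⟩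
  · exact (memLp_two_iff_integrable_sq_norm (D.memLp_hHat k m).1).1 (D.memLp_hHat k m)
  · rw [SwiptModel.SE, D.sinr_eq_sinrPZF hM hE k]
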